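/- Let $\{\varepsilon_t\}_{t\in\mathbb Z}$ be i.i.d. random variables, let $g_t$ ($t\in\mathbb Z$) be measurable functions, and let $X_t=g_t(\varepsilon_t,\varepsilon_{t-1},\dots)$, $t\in\mathbb Z$, be a (strictly) stationary process with $\mathbb E X_t=0$ and $\mathbb E|X_t|^d<\infty$ for some real $d\ge 4$. Assume that, for all sufficiently large $n$, $\sup_{1\le t\le n}|X_t|\le\sqrt n$ almost surely. Let $\{\varepsilon'_t\}$ be an independent copy of $\{\varepsilon_t\}$ and let $X_t^{(\ell,\prime)}$ be obtained from $X_t=g_t(\varepsilon_t,\varepsilon_{t-1},\dots)$ by replacing $\varepsilon_{t-\ell}$ with $\varepsilon'_{t-\ell}$. With $\|Z\|_d=(\mathbb E|Z|^d)^{1/d}$ put $$\Theta_{X,d}(k)=\sum_{\ell=k}^{\infty}\ \sup_{t\in\mathbb Z}\big\|X_t-X_t^{(\ell,\prime)}\big\|_d\in[0,\infty]$$ (if $g_t$ does not depend on $t$, this is $\sum_{t\ge k}\|X_t-X_t'\|_d$, where $X_t'$ is $X_t$ with $\varepsilon_0$ replaced by $\varepsilon_0'$). Let $(\tau_n)$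 be a positive sequence with $\tau_n/\log n\to\infty$ and let $(c_n)$ be a real sequence with $c_n=o(\log[\tau_n/\log n])$, where $[x]$ denotes the integer part of $x$. Then, as $n\to\infty$, $$\mathbb P\Big(\Big|\frac1n\sum_{t=1}^nX_t\Big|\ge\frac{\tau_n}{\sqrt n}\Big)\le O(n^{-c_n})+\frac{K\,\Theta_{X,d}^d([\tau_n])}{\tau_n^d},$$ where $K>0$ depends only on $d$, and the constant in $O(\cdot)$ may depend on the process and on the sequences $(\tau_n)$, $(c_n)$. -/

import Mathlib

open MeasureTheory ProbabilityTheory Filter Topology Asymptotics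
open scoped ENNReal

noncomputable section

namespace Causal

variable {Ω E : Type*} [MeasurableSpace Ω] [MeasurableSpace E]

/-- The innovations up to time `t`, listed backwards: `(ε_t, ε_{t-1}, ε_{t-2}, …)`. -/
def past (ε : ℤ → Ω → E) (t : ℤ) (ω : Ω) : ℕ → E := fun j => ε (t - (j : ℤ)) ω

/-- The causal process `X_t = g_t(ε_t, ε_{t-1}, …)`. -/
def proc (g : ℤ → (ℕ → E) → ℝ) (ε : ℤ → Ω → E) (t : ℤ) (ω : Ω) : ℝ := g t (past ε t ω)

/-- `X_t^{(ℓ,')}`: the innovation `ε_{t-ℓ}` in `X_t` is replaced by `ε'_{t-ℓ}`, where `ε'` is an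
independent copy of `ε`. Here `(ω, ω') ∈ Ω × Ω`, the product space carries `μ × μ`, the sequence `ε`
is read off from `ω` and its independent copy `ε'` from `ω'`. -/
def coupled (g : ℤ → (ℕ → E) → ℝ) (ε : ℤ → Ω → E) (ℓ : ℕ) (t : ℤ) (p : Ω × Ω) : ℝ :=
  g t (Function.update (past ε t p.1) ℓ (ε (t - (ℓ : ℤ)) p.2))

/-- `‖X_t - X_t^{(ℓ,')}‖_d`. -/
def couplingNorm (μ : Measure Ω) (g : ℤ → (ℕ → E) → ℝ) (ε : ℤ → Ω → E) (d : ℝ) (ℓ : ℕ) (t : ℤ) :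
    ℝ≥0∞ :=
  eLpNorm (fun p : Ω × Ω => proc g ε t p.1 - coupled g ε ℓ t p) (ENNReal.ofReal d) (μ.prod μ)

/-- `Θ_{X,d}(k) = ∑_{ℓ ≥ k} sup_t ‖X_t - X_t^{(ℓ,')}‖_d`, a value in `[0, ∞]`. If `g_t` does not
depend on `t`, the norm does not depend on `t`, and taking `t = ℓ` (so that it is `ε_0` that is
replaced) gives `∑_{t ≥ k} ‖X_t - X_t'‖_d`; see `Theta_eq_of_timeInvariant`. -/
def Theta (μ : Measure Ω) (g : ℤ → (ℕ → E) → ℝ) (ε : ℤ → Ω → E) (d : ℝ) (k : ℕ) : ℝ≥0∞ :=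
  ∑' j : ℕ, ⨆ t : ℤ, couplingNorm μ g ε d (k + j) t

/-- An i.i.d. sequence indexed by `ℤ`. -/
structure IsIID (μ : Measure Ω) (ε : ℤ → Ω → E) : Prop where
  measurable : ∀ t, Measurable (ε t)
  indep : iIndepFun ε μ
  identDistrib : ∀ t, IdentDistrib (ε t) (ε 0) μ μ

/-- (Strict) stationarity: the law of the whole process is invariant under time shifts. -/
def IsStationary (μ : Measure Ω) (X : ℤ → Ω → ℝ) : Prop :=
  ∀ h : ℤ, IdentDistrib (fun ω (t : ℤ) => X (t + h) ω) (fun ω (t : ℤ) => X t ω) μ μ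

theorem map_past_eq {μ : Measure Ω} [IsProbabilityMeasure μ] {ε : ℤ → Ω → E} (hε : IsIID μ ε)
    (t : ℤ) : μ.map (past ε t) = Measure.infinitePi (fun _ : ℕ => μ.map (ε 0)) := by
  have hinj : Function.Injective (fun j : ℕ => t - (j : ℤ)) := by
    intro a b h
    simp only at h
    omega
  have h := (iIndepFun_iff_map_fun_eq_infinitePi_map
    (fun j : ℕ => hε.measurable (t - (j : ℤ)))).1 (hε.indep.precomp hinj)
  exact h.trans (by simp only [(hε.identDistrib _).map_eq])

theorem couplingNorm_eq_of_timeInvariant {μ : Measure Ω} [IsProbabilityMeasure μ]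
    {ε : ℤ → Ω → E} (hε : IsIID μ ε) {g : ℤ → (ℕ → E) → ℝ} {g₀ : (ℕ → E) → ℝ}
    (hg₀ : Measurable g₀) (hg : ∀ t, g t = g₀) (d : ℝ) (ℓ : ℕ) (t : ℤ) :
    couplingNorm μ g ε d ℓ t = eLpNorm (fun q : (ℕ → E) × E =>
      g₀ q.1 - g₀ (Function.update q.1 ℓ q.2)) (ENNReal.ofReal d)
        ((Measure.infinitePi (fun _ : ℕ => μ.map (ε 0))).prod (μ.map (ε 0))) := by
  have hp : Measurable (past ε t) := measurable_pi_lambda _ fun j => hε.measurable _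
  have hu : Measurable fun q : (ℕ → E) × E => Function.update q.1 ℓ q.2 := by
    refine measurable_pi_lambda _ fun j => ?_
    by_cases h : j = ℓ
    · subst h
      simpa using measurable_snd
    · simp only [Function.update_of_ne h]
      exact (measurable_pi_apply j).comp measurable_fst
  have hF : Measurable fun q : (ℕ → E) × E => g₀ q.1 - g₀ (Function.update q.1 ℓ q.2) :=
    (hg₀.comp measurable_fst).sub (hg₀.comp hu)
  rw [← map_past_eq hε t, ← (hε.identDistrib (t - (ℓ : ℤ))).map_eq,
    Measure.map_prod_map _ _ hp (hε.measurable _), eLpNorm_map_measure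
      hF.aestronglyMeasurable (hp.prodMap (hε.measurable _)).aemeasurable]
  unfold couplingNorm proc coupled
  simp only [hg]
  rfl

/-- For a time-invariant `g_t = g₀`: `Θ_{X,d}(k) = ∑_{t ≥ k} ‖X_t - X_t'‖_d`, where `ε_0` is
replaced by `ε_0'` in `X_t'`. -/
theorem Theta_eq_of_timeInvariant {μ : Measure Ω} [IsProbabilityMeasure μ]
    {ε : ℤ → Ω → E} (hε : IsIID μ ε) {g : ℤ → (ℕ → E) → ℝ} {g₀ : (ℕ → E) → ℝ}
    (hg₀ : Measurable g₀) (hg : ∀ t, g t = g₀) (d : ℝ) (k : ℕ) :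
    Theta μ g ε d k = ∑' j : ℕ, couplingNorm μ g ε d (k + j) ((k + j : ℕ) : ℤ) := by
  unfold Theta
  simp only [couplingNorm_eq_of_timeInvariant hε hg₀ hg, iSup_const]

end Causal

end

/-! ### Moment inequality for sums of bounded martingale differences -/

namespace Causal

/-! Stationarity turns the bound by `√n`, used for a single `n`, into one almost sure bound `B`
valid at all times (`IsStationary.exists_bound`). The rest is an approximation by `m`-dependent
variables with `m = ⌊τ n⌋₊`.

Condition `X_t` on the innovations from time `t - m + 1` on. Read backwards in time, these
σ-algebras increase. The conditional expectations `Y_t` are bounded by `B` and become centred when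
conditioned on the innovations after `t`, so they are `m`-step martingale differences. Splitting the
times into residue classes mod `m`, Jensen and Azuma–Hoeffding bound the probability that `|∑ Y_t| ≥
τ√n/2` by `2 exp(-τ/(16 B²))`, since `m ≤ τ` and `m ≤ n` (`measure_abs_sum_ge_le_of_step`). As `c_n`
is eventually at most any fixed multiple of `τ_n / log n`, this is `O(n^{-c_n})`.

The remainder `X_t - Y_t` telescopes over `ℓ ≥ m` into increments obtained by adding `ε_{t-ℓ}` to
the conditioning. Such an increment is the conditional expectation of the effect of resampling
`ε_{t-ℓ}`, so its `L^d` norm is at most the coupling norm (`eLpNorm_condExp_sub_condExp_le`). For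
fixed `ℓ` the increments are martingale differences in reversed time, and a Burkholder-type
inequality (`eLpNorm_martingale_sum_le`) gives a factor `√n`. Summing over `ℓ` gives `√n Θ(m)` up to
a constant, and Markov's inequality at order `d` gives the polynomial term. Only `d > 2` enters. -/

theorem one_add_rpow_le_one_add_mul {p s : ℝ} (hp : 1 ≤ p) (hs : -1 < s) :
    (1 + s) ^ p ≤ 1 + p * (s * (1 + s) ^ (p - 1)) := by
  have h1 : 0 < 1 + s := by linarith
  -- Bernoulli's inequality at the reciprocal of `1 + s`; multiplying by `(1 + s) ^ p` turns it into
  -- an upper bound.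
  have hb := one_add_mul_self_le_rpow_one_add (s := (1 + s)⁻¹ - 1)
    (by linarith [inv_pos.2 h1]) hp
  rw [add_sub_cancel, Real.inv_rpow h1.le] at hb
  have hpos : 0 < (1 + s) ^ p := Real.rpow_pos_of_pos h1 p
  have hb' := mul_le_mul_of_nonneg_right hb hpos.le
  rw [inv_mul_cancel₀ hpos.ne'] at hb'
  have hsplit : (1 + s) ^ p = (1 + s) ^ (p - 1) * (1 + s) := by
    rw [← Real.rpow_add_one h1.ne', sub_add_cancel]
  have : (1 + p * ((1 + s)⁻¹ - 1)) * (1 + s) ^ p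
      = (1 + s) ^ p - p * (s * (1 + s) ^ (p - 1)) := by
    rw [hsplit]
    field_simp
    ring
  linarith

/-- A second-order Taylor bound near zero; for `|s| ≥ 1` everything is absorbed by `|s| ^ p`, and
the linear term by `s ^ 2`. -/
theorem abs_one_add_rpow_le {p : ℝ} (hp : 2 ≤ p) (s : ℝ) :
    |1 + s| ^ p ≤ 1 + p * s + p ^ 2 * 2 ^ p * (s ^ 2 + |s| ^ p) := by
  have h2 : (1 : ℝ) ≤ 2 ^ p := Real.one_le_rpow (by norm_num) (by linarith)
  have hs0 : 0 ≤ |s| ^ p := by positivity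
  rcases le_or_gt 1 |s| with h | h
  · have h3 : |1 + s| ≤ 2 * |s| := by
      have := abs_add_le 1 s
      rw [abs_one] at this
      linarith
    have h4 : |1 + s| ^ p ≤ 2 ^ p * |s| ^ p := by
      rw [← Real.mul_rpow (by norm_num) (abs_nonneg _)]
      exact Real.rpow_le_rpow (abs_nonneg _) h3 (by linarith)
    have h5 : -(s ^ 2) ≤ s := by
      rw [← sq_abs]
      nlinarith [neg_abs_le s]
    have h6 : p ≤ p ^ 2 * 2 ^ p := by nlinarith
    have h7 : p * -(s ^ 2) ≤ p * s := mul_le_mul_of_nonneg_left h5 (by linarith)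
    have h8 : (2 : ℝ) ^ p ≤ p ^ 2 * 2 ^ p := le_mul_of_one_le_left (by positivity) (by nlinarith)
    have h9 := mul_le_mul_of_nonneg_right h8 hs0
    have h10 := mul_le_mul_of_nonneg_right h6 (sq_nonneg s)
    nlinarith
  · obtain ⟨hl, hr⟩ := abs_lt.1 h
    have h1 : 0 < 1 + s := by linarith
    rw [abs_of_pos h1]
    have ha := one_add_rpow_le_one_add_mul (p := p) (by linarith) hl
    have key : s * (1 + s) ^ (p - 1) ≤ s + p * 2 ^ p * s ^ 2 := by
      -- For `s ≥ 0` the previous upper bound is reused at exponent `p - 1`; for `s < 0` Bernoulli's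
      -- lower bound suffices, because multiplying by `s` reverses it.
      rcases le_or_gt 0 s with h0 | h0
      · have hb := one_add_rpow_le_one_add_mul (p := p - 1) (by linarith) hl
        have hc : (1 + s) ^ (p - 1 - 1) ≤ 2 ^ p :=
          (Real.rpow_le_rpow h1.le (by linarith) (by linarith)).trans
            (Real.rpow_le_rpow_of_exponent_le (by norm_num) (by linarith))
        have hd : (p - 1) * (s * (1 + s) ^ (p - 1 - 1)) ≤ p * (s * 2 ^ p) := by
          gcongr
          linarith
        nlinarith
      · have hb := one_add_mul_self_le_rpow_one_add (s := s) hl.le (p := p - 1) (by linarith)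
        have hc := mul_le_mul_of_nonpos_left hb h0.le
        have hd : (p - 1) * s ^ 2 ≤ p * 2 ^ p * s ^ 2 := by
          gcongr
          nlinarith
        nlinarith
    have hk := mul_le_mul_of_nonneg_left key (by linarith : 0 ≤ p)
    have : 0 ≤ p ^ 2 * 2 ^ p * |s| ^ p := by positivity
    nlinarith

theorem abs_add_rpow_le {p : ℝ} (hp : 2 < p) (y u : ℝ) :
    |y + u| ^ p ≤ |y| ^ p + p * (y * |y| ^ (p - 2)) * u
      + p ^ 2 * 2 ^ p * (|y| ^ (p - 2) * u ^ 2 + |u| ^ p) := by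
  rcases eq_or_ne y 0 with rfl | hy
  · have h2 : (1 : ℝ) ≤ 2 ^ p := Real.one_le_rpow (by norm_num) (by linarith)
    have h3 : 0 ≤ |u| ^ p := by positivity
    have h4 : 1 ≤ p ^ 2 * 2 ^ p := by nlinarith
    simp only [zero_add, abs_zero, Real.zero_rpow (by linarith : p ≠ 0),
      Real.zero_rpow (by linarith : p - 2 ≠ 0), zero_mul, mul_zero]
    exact le_mul_of_one_le_left h3 h4
  · have hy' : 0 < |y| := abs_pos.2 hy
    have h := mul_le_mul_of_nonneg_left (abs_one_add_rpow_le hp.le (u / y))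
      (Real.rpow_nonneg hy'.le p)
    rw [← Real.mul_rpow (abs_nonneg _) (abs_nonneg _), ← abs_mul, mul_add, mul_one,
      mul_div_cancel₀ _ hy] at h
    refine h.trans (le_of_eq ?_)
    have hsplit : |y| ^ p = |y| ^ (p - 2) * y ^ 2 := by
      rw [← sq_abs y, ← Real.rpow_natCast |y| 2, ← Real.rpow_add hy']
      norm_num
    have hu : |y| ^ p * |u / y| ^ p = |u| ^ p := by
      rw [← Real.mul_rpow (abs_nonneg _) (abs_nonneg _), ← abs_mul, mul_div_cancel₀ _ hy]
    have e1 : |y| ^ p * (u / y) = y * |y| ^ (p - 2) * u := by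
      rw [hsplit]; field_simp
    have e2 : |y| ^ p * (u / y) ^ 2 = |y| ^ (p - 2) * u ^ 2 := by
      rw [hsplit]; field_simp
    linear_combination p * e1 + p ^ 2 * 2 ^ p * (e2 + hu)

/-- A superadditivity estimate that closes the induction in `integral_abs_sum_rpow_le`. -/
theorem rpow_add_mul_le {q A x b : ℝ} (hq : 1 ≤ q) (hA : 1 ≤ A) (hx : 0 ≤ x) (hb : 0 ≤ b) :
    x ^ q + A * (x ^ (q - 1) * b + b ^ q) ≤ (x + 2 * A * b) ^ q := by
  -- Each error term, with coefficient `2 * A`, fits under the right side separately; averaging the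
  -- two bounds gives the claim, hence the factor 2.
  have hc : 0 ≤ 2 * A * b := by positivity
  have h1 : x ^ q + (2 * A * b) ^ q ≤ (x + 2 * A * b) ^ q :=
    Real.add_rpow_le_rpow_add hx hc hq
  have h2 : x ^ q + 2 * A * (x ^ (q - 1) * b) ≤ (x + 2 * A * b) ^ q := by
    rcases hx.eq_or_lt with rfl | hx
    · rcases hq.eq_or_lt with rfl | hq
      · simp [mul_assoc]
      · rw [Real.zero_rpow (by linarith), Real.zero_rpow (by linarith)]
        simp only [zero_mul, mul_zero, add_zero]
        positivity
    · have hs : 0 ≤ 2 * A * b / x := by positivity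
      have h := one_add_mul_self_le_rpow_one_add (s := 2 * A * b / x) (by linarith) hq
      have h' := mul_le_mul_of_nonneg_left h (Real.rpow_nonneg hx.le q)
      rw [← Real.mul_rpow hx.le (by linarith), mul_add x, mul_one, mul_div_cancel₀ _ hx.ne'] at h'
      refine le_trans ?_ h'
      have hsplit : x ^ q = x ^ (q - 1) * x := by
        rw [← Real.rpow_add_one hx.ne', sub_add_cancel]
      have : x ^ q * (1 + q * (2 * A * b / x)) = x ^ q + q * (2 * A * (x ^ (q - 1) * b)) := by
        rw [hsplit]; field_simp
      rw [this]
      have : 0 ≤ 2 * A * (x ^ (q - 1) * b) := by positivity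
      nlinarith
  have h3 : 2 * A * b ^ q ≤ (2 * A * b) ^ q := by
    rw [Real.mul_rpow (by positivity) hb]
    gcongr
    exact Real.self_le_rpow_of_one_le (by linarith) hq
  nlinarith

variable {Ω : Type*} {m m0 : MeasurableSpace Ω} {μ : Measure Ω}

theorem integral_mul_eq_zero_of_condExp_eq_zero [IsProbabilityMeasure μ]
    (hm : m ≤ m0) {f D : Ω → ℝ} (hf : StronglyMeasurable[m] f) (hfD : Integrable (f * D) μ)
    (hD : Integrable D μ) (h0 : μ[D | m] =ᵐ[μ] 0) : ∫ ω, f ω * D ω ∂μ = 0 := by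
  have h := condExp_mul_of_stronglyMeasurable_left hf hfD hD
  have h' : μ[f * D | m] =ᵐ[μ] 0 := by
    filter_upwards [h, h0] with ω h1 h2
    rw [h1, Pi.mul_apply, h2]
    simp
  calc ∫ ω, f ω * D ω ∂μ = ∫ ω, (μ[f * D | m]) ω ∂μ := (integral_condExp hm).symm
    _ = 0 := by rw [integral_congr_ae h']; simp

theorem integrable_of_abs_le [IsFiniteMeasure μ] {f : Ω → ℝ} (hf : AEStronglyMeasurable f μ)
    {B : ℝ} (hB : ∀ᵐ ω ∂μ, |f ω| ≤ B) : Integrable f μ :=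
  Integrable.of_bound hf B (by simpa only [Real.norm_eq_abs] using hB)

/-- One step of the moment inequality for martingale differences. -/
theorem integral_abs_add_rpow_le [IsProbabilityMeasure μ] {p : ℝ} (hp : 2 < p)
    (hm : m ≤ m0) {Y D : Ω → ℝ} (hY : StronglyMeasurable[m] Y)
    (hD : AEStronglyMeasurable D μ) {B : ℝ} (hYB : ∀ᵐ ω ∂μ, |Y ω| ≤ B)
    (hDB : ∀ᵐ ω ∂μ, |D ω| ≤ B) (h0 : μ[D | m] =ᵐ[μ] 0) {x b : ℝ} (hx : 0 ≤ x) (hb : 0 ≤ b)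
    (hYx : ∫ ω, |Y ω| ^ p ∂μ ≤ x ^ (p / 2)) (hDb : ∫ ω, |D ω| ^ p ∂μ ≤ b ^ (p / 2)) :
    ∫ ω, |Y ω + D ω| ^ p ∂μ ≤ (x + 2 * (p ^ 2 * 2 ^ p) * b) ^ (p / 2) := by
  have hp0 : 0 < p := by linarith
  have hYm : StronglyMeasurable Y := hY.mono hm
  have hrpow : ∀ {r : ℝ}, 0 ≤ r → Continuous fun y : ℝ => |y| ^ r := fun hr =>
    continuous_abs.rpow_const fun _ => Or.inr hr
  have hmeas : ∀ {r : ℝ}, 0 ≤ r → ∀ {f : Ω → ℝ}, AEStronglyMeasurable f μ →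
      AEStronglyMeasurable (fun ω => |f ω| ^ r) μ := fun hr f hf =>
    (hrpow hr).comp_aestronglyMeasurable hf
  have hle : ∀ {r : ℝ}, 0 ≤ r → ∀ {f : Ω → ℝ} {B' : ℝ}, (∀ᵐ ω ∂μ, |f ω| ≤ B') →
      ∀ᵐ ω ∂μ, |(|f ω| ^ r)| ≤ B' ^ r := fun hr f B' hf => by
    filter_upwards [hf] with ω h
    rw [abs_of_nonneg (by positivity)]
    exact Real.rpow_le_rpow (abs_nonneg _) h hr
  have hfi : ∀ {r : ℝ}, 0 ≤ r → ∀ {f : Ω → ℝ} {B' : ℝ}, AEStronglyMeasurable f μ →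
      (∀ᵐ ω ∂μ, |f ω| ≤ B') → Integrable (fun ω => |f ω| ^ r) μ := fun hr f B' hf hB =>
    integrable_of_abs_le (hmeas hr hf) (hle hr hB)
  have hYp := hfi hp0.le hYm.aestronglyMeasurable hYB
  have hDp := hfi hp0.le hD hDB
  have hφ : StronglyMeasurable[m] fun ω => Y ω * |Y ω| ^ (p - 2) :=
    (continuous_id.mul (hrpow (by linarith))).comp_stronglyMeasurable hY
  have hφB : ∀ᵐ ω ∂μ, |Y ω * |Y ω| ^ (p - 2)| ≤ B * B ^ (p - 2) := by
    filter_upwards [hYB, hle (by linarith : 0 ≤ p - 2) hYB] with ω h1 h2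
    rw [abs_mul]
    exact mul_le_mul h1 h2 (abs_nonneg _) ((abs_nonneg _).trans h1)
  have hφD : Integrable ((fun ω => Y ω * |Y ω| ^ (p - 2)) * D) μ := by
    refine integrable_of_abs_le ((hφ.mono hm).aestronglyMeasurable.mul hD)
      (B := B * B ^ (p - 2) * B) ?_
    filter_upwards [hφB, hDB] with ω h1 h2
    rw [Pi.mul_apply, abs_mul]
    exact mul_le_mul h1 h2 (abs_nonneg _) ((abs_nonneg _).trans h1)
  have hφD' : Integrable (fun ω => p * ((Y ω * |Y ω| ^ (p - 2)) * D ω)) μ := hφD.const_mul p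
  -- The first-order term of the expansion has mean zero, since its factor `Y * |Y| ^ (p - 2)` is
  -- `m`-measurable.
  have hcross := integral_mul_eq_zero_of_condExp_eq_zero hm hφ hφD
    (integrable_of_abs_le hD hDB) h0
  have hD2 : ∀ᵐ ω ∂μ, |D ω ^ 2| ≤ B ^ 2 := by
    filter_upwards [hDB] with ω h
    rw [abs_pow]
    exact pow_le_pow_left₀ (abs_nonneg _) h 2
  have hYD : Integrable (fun ω => |Y ω| ^ (p - 2) * D ω ^ 2) μ := by
    refine integrable_of_abs_le ((hmeas (by linarith : 0 ≤ p - 2) hYm.aestronglyMeasurable).mul (hD.pow 2))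
      (B := B ^ (p - 2) * B ^ 2) ?_
    filter_upwards [hle (by linarith : 0 ≤ p - 2) hYB, hD2] with ω h1 h2
    rw [abs_mul]
    exact mul_le_mul h1 h2 (abs_nonneg _) ((abs_nonneg _).trans h1)
  have hYDp : Integrable (fun ω => p ^ 2 * 2 ^ p * (|Y ω| ^ (p - 2) * D ω ^ 2 + |D ω| ^ p)) μ :=
    (hYD.add hDp).const_mul _
  have hYYD : Integrable (fun ω => |Y ω| ^ p + p * ((Y ω * |Y ω| ^ (p - 2)) * D ω)) μ :=
    hYp.add hφD'
  have hholder : ∫ ω, |Y ω| ^ (p - 2) * D ω ^ 2 ∂μ ≤ x ^ (p / 2 - 1) * b := by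
    have hpq : (p / (p - 2)).HolderConjugate (p / 2) := by
      rw [Real.holderConjugate_iff]
      refine ⟨by rw [one_lt_div] <;> linarith, ?_⟩
      have : p - 2 ≠ 0 := by linarith
      field_simp
      ring
    have hmem : ∀ {f : Ω → ℝ} {B' : ℝ} {r : ℝ≥0∞}, AEStronglyMeasurable f μ →
        (∀ᵐ ω ∂μ, |f ω| ≤ B') → MemLp f r μ := fun hf hB =>
      MemLp.of_bound hf _ (by simpa only [Real.norm_eq_abs] using hB)
    refine (integral_mul_le_Lp_mul_Lq_of_nonneg (f := fun ω => |Y ω| ^ (p - 2))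
      (g := fun ω => D ω ^ 2) hpq (Eventually.of_forall fun ω => by positivity)
      (Eventually.of_forall fun ω => by positivity)
      (hmem (hmeas (by linarith : 0 ≤ p - 2) hYm.aestronglyMeasurable) (hle (by linarith : 0 ≤ p - 2) hYB))
      (hmem (hD.pow 2) hD2)).trans ?_
    have e1 : ∀ ω, (|Y ω| ^ (p - 2)) ^ (p / (p - 2)) = |Y ω| ^ p := fun ω => by
      rw [← Real.rpow_mul (abs_nonneg _), mul_div_cancel₀ _ (by linarith : p - 2 ≠ 0)]
    have e2 : ∀ ω, (D ω ^ 2) ^ (p / 2) = |D ω| ^ p := fun ω => by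
      rw [← sq_abs, ← Real.rpow_natCast |D ω| 2, ← Real.rpow_mul (abs_nonneg _)]
      congr 1
      push_cast
      ring
    simp only [e1, e2]
    refine mul_le_mul ?_ ?_ (by positivity) (by positivity)
    · calc (∫ ω, |Y ω| ^ p ∂μ) ^ (1 / (p / (p - 2))) ≤ (x ^ (p / 2)) ^ (1 / (p / (p - 2))) :=
            Real.rpow_le_rpow (integral_nonneg fun ω => by positivity) hYx
              (one_div_nonneg.2 hpq.nonneg)
        _ = x ^ (p / 2 - 1) := by
            rw [← Real.rpow_mul hx]
            congr 1
            field_simp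
    · calc (∫ ω, |D ω| ^ p ∂μ) ^ (1 / (p / 2)) ≤ (b ^ (p / 2)) ^ (1 / (p / 2)) :=
            Real.rpow_le_rpow (integral_nonneg fun ω => by positivity) hDb (by positivity)
        _ = b := by
            rw [← Real.rpow_mul hb, mul_one_div_cancel (by positivity), Real.rpow_one]
  have hlast := rpow_add_mul_le (q := p / 2) (A := p ^ 2 * 2 ^ p) (by linarith) (by
    have h2 : (1 : ℝ) ≤ 2 ^ p := Real.one_le_rpow (by norm_num) hp0.le
    nlinarith) hx hb
  calc ∫ ω, |Y ω + D ω| ^ p ∂μ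
      ≤ ∫ ω, (|Y ω| ^ p + p * ((Y ω * |Y ω| ^ (p - 2)) * D ω)
        + p ^ 2 * 2 ^ p * (|Y ω| ^ (p - 2) * D ω ^ 2 + |D ω| ^ p)) ∂μ := by
        refine integral_mono (hfi hp0.le (B' := B + B) (hYm.aestronglyMeasurable.add hD) ?_)
          (hYYD.add hYDp) fun ω => ?_
        · filter_upwards [hYB, hDB] with ω h1 h2
          exact (abs_add_le _ _).trans (add_le_add h1 h2)
        · simpa only [mul_assoc] using abs_add_rpow_le hp (Y ω) (D ω)
    _ = ∫ ω, |Y ω| ^ p ∂μ + p * ∫ ω, (Y ω * |Y ω| ^ (p - 2)) * D ω ∂μ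
        + p ^ 2 * 2 ^ p * (∫ ω, |Y ω| ^ (p - 2) * D ω ^ 2 ∂μ + ∫ ω, |D ω| ^ p ∂μ) := by
        rw [integral_add hYYD hYDp,
          integral_add hYp hφD', integral_const_mul, integral_const_mul,
          integral_add hYD hDp]
    _ ≤ x ^ (p / 2) + p ^ 2 * 2 ^ p * (x ^ (p / 2 - 1) * b + b ^ (p / 2)) := by
        rw [hcross, mul_zero, add_zero]
        gcongr
    _ ≤ _ := hlast

theorem abs_sum_range_le_of_ae {f : ℕ → Ω → ℝ} {B : ℝ} (hf : ∀ i, ∀ᵐ ω ∂μ, |f i ω| ≤ B) (n : ℕ) :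
    ∀ᵐ ω ∂μ, |∑ i ∈ Finset.range n, f i ω| ≤ n * B := by
  filter_upwards [ae_all_iff.2 hf] with ω h
  calc |∑ i ∈ Finset.range n, f i ω| ≤ ∑ i ∈ Finset.range n, |f i ω| :=
        Finset.abs_sum_le_sum_abs _ _
    _ ≤ ∑ _i ∈ Finset.range n, B := Finset.sum_le_sum fun i _ => h i
    _ = n * B := by simp

theorem integral_abs_sum_rpow_le [IsProbabilityMeasure μ] {p : ℝ} (hp : 2 < p)
    {𝒢 : ℕ → MeasurableSpace Ω} (h𝒢 : ∀ i, 𝒢 i ≤ m0) (hmono : Monotone 𝒢) {D : ℕ → Ω → ℝ}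
    (hD : ∀ i, StronglyMeasurable[𝒢 (i + 1)] (D i)) {B : ℝ} (hB : ∀ i, ∀ᵐ ω ∂μ, |D i ω| ≤ B)
    (h0 : ∀ i, μ[D i | 𝒢 i] =ᵐ[μ] 0) {b : ℝ} (hb : 0 ≤ b) (n : ℕ)
    (hDb : ∀ i < n, ∫ ω, |D i ω| ^ p ∂μ ≤ b ^ (p / 2)) :
    ∫ ω, |∑ i ∈ Finset.range n, D i ω| ^ p ∂μ ≤ (n * (2 * (p ^ 2 * 2 ^ p) * b)) ^ (p / 2) := by
  have hB0 : 0 ≤ B := by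
    obtain ⟨ω, h⟩ := (hB 0).exists
    exact (abs_nonneg _).trans h
  induction n with
  | zero => simp [Real.zero_rpow (by linarith : p ≠ 0), Real.zero_rpow (by linarith : p / 2 ≠ 0)]
  | succ n ih =>
    have hS : StronglyMeasurable[𝒢 n] fun ω => ∑ i ∈ Finset.range n, D i ω :=
      Finset.stronglyMeasurable_fun_sum _ fun i hi =>
        (hD i).mono (hmono (Finset.mem_range.1 hi))
    have h := integral_abs_add_rpow_le hp (h𝒢 n) hS ((hD n).mono (h𝒢 _)).aestronglyMeasurable
      (B := (n + 1) * B) ((abs_sum_range_le_of_ae hB n).mono fun ω h => h.trans (by nlinarith))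
      ((hB n).mono fun ω h => h.trans (by nlinarith [(Nat.cast_nonneg n : (0 : ℝ) ≤ n)])) (h0 n)
      (x := n * (2 * (p ^ 2 * 2 ^ p) * b)) (by positivity) hb
      (ih fun i hi => hDb i (hi.trans n.lt_succ_self)) (hDb n n.lt_succ_self)
    simp only [Finset.sum_range_succ]
    refine h.trans (le_of_eq ?_)
    push_cast
    ring_nf

/-- A moment inequality of Burkholder type for bounded martingale differences. -/
theorem eLpNorm_martingale_sum_le [IsProbabilityMeasure μ] {p : ℝ} (hp : 2 < p)
    {𝒢 : ℕ → MeasurableSpace Ω} (h𝒢 : ∀ i, 𝒢 i ≤ m0) (hmono : Monotone 𝒢) {D : ℕ → Ω → ℝ}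
    (hD : ∀ i, StronglyMeasurable[𝒢 (i + 1)] (D i)) {B : ℝ} (hB : ∀ i, ∀ᵐ ω ∂μ, |D i ω| ≤ B)
    (h0 : ∀ i, μ[D i | 𝒢 i] =ᵐ[μ] 0) {N : ℝ≥0∞} (n : ℕ)
    (hN : ∀ i < n, eLpNorm (D i) (ENNReal.ofReal p) μ ≤ N) :
    eLpNorm (fun ω => ∑ i ∈ Finset.range n, D i ω) (ENNReal.ofReal p) μ
      ≤ ENNReal.ofReal (√(2 * (p ^ 2 * 2 ^ p)) * √n) * N := by
  have hp0 : 0 < p := by linarith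
  rcases eq_or_ne N ∞ with rfl | hNtop
  · rcases Nat.eq_zero_or_pos n with rfl | hn
    · simp
    · rw [ENNReal.mul_top]
      · exact le_top
      · rw [Ne, ENNReal.ofReal_eq_zero, not_le]
        positivity
  lift N to NNReal using hNtop
  have hpe : ENNReal.ofReal p ≠ 0 := by simpa using hp0
  have hnorm : ∀ {f : Ω → ℝ} {B' : ℝ}, AEStronglyMeasurable f μ → (∀ᵐ ω ∂μ, |f ω| ≤ B') →
      eLpNorm f (ENNReal.ofReal p) μ = ENNReal.ofReal ((∫ ω, |f ω| ^ p ∂μ) ^ p⁻¹) :=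
    fun {f B'} hf hB => by
      have hmem : MemLp f (ENNReal.ofReal p) μ :=
        MemLp.of_bound hf B' (by simpa only [Real.norm_eq_abs] using hB)
      rw [hmem.eLpNorm_eq_integral_rpow_norm hpe ENNReal.ofReal_ne_top,
        ENNReal.toReal_ofReal hp0.le]
      simp only [Real.norm_eq_abs]
  have hDm : ∀ i, AEStronglyMeasurable (D i) μ := fun i =>
    ((hD i).mono (h𝒢 _)).aestronglyMeasurable
  have hDb : ∀ i < n, ∫ ω, |D i ω| ^ p ∂μ ≤ ((N : ℝ) ^ 2) ^ (p / 2) := fun i hi => by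
    have h := hN i hi
    rw [hnorm (hDm i) (hB i), ← ENNReal.ofReal_coe_nnreal,
      ENNReal.ofReal_le_ofReal_iff N.coe_nonneg] at h
    have hI : 0 ≤ ∫ ω, |D i ω| ^ p ∂μ := integral_nonneg fun ω => by positivity
    calc ∫ ω, |D i ω| ^ p ∂μ = ((∫ ω, |D i ω| ^ p ∂μ) ^ p⁻¹) ^ p := by
          rw [← Real.rpow_mul hI, inv_mul_cancel₀ hp0.ne', Real.rpow_one]
      _ ≤ (N : ℝ) ^ p := Real.rpow_le_rpow (by positivity) h hp0.le
      _ = ((N : ℝ) ^ 2) ^ (p / 2) := by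
          rw [← Real.rpow_natCast (N : ℝ) 2, ← Real.rpow_mul N.coe_nonneg]
          congr 1
          push_cast
          ring
  have hmain := integral_abs_sum_rpow_le hp h𝒢 hmono hD hB h0 (sq_nonneg (N : ℝ)) n hDb
  have hSm : AEStronglyMeasurable (fun ω => ∑ i ∈ Finset.range n, D i ω) μ :=
    (Finset.stronglyMeasurable_fun_sum _ fun i _ => (hD i).mono (h𝒢 _)).aestronglyMeasurable
  rw [hnorm hSm (abs_sum_range_le_of_ae hB n), ← ENNReal.ofReal_coe_nnreal,
    ← ENNReal.ofReal_mul (by positivity)]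
  refine ENNReal.ofReal_le_ofReal ?_
  calc (∫ ω, |∑ i ∈ Finset.range n, D i ω| ^ p ∂μ) ^ p⁻¹
      ≤ ((n * (2 * (p ^ 2 * 2 ^ p) * (N : ℝ) ^ 2)) ^ (p / 2)) ^ p⁻¹ :=
        Real.rpow_le_rpow (integral_nonneg fun ω => by positivity) hmain (by positivity)
    _ = √(n * (2 * (p ^ 2 * 2 ^ p) * (N : ℝ) ^ 2)) := by
        rw [← Real.rpow_mul (by positivity), Real.sqrt_eq_rpow]
        congr 1
        field_simp
    _ = √(2 * (p ^ 2 * 2 ^ p)) * √n * N := by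
        rw [← mul_assoc, Real.sqrt_mul (by positivity), Real.sqrt_sq N.coe_nonneg,
          Real.sqrt_mul (by positivity)]
        ring

end Causal

/-! ### Azuma–Hoeffding for `k`-step martingale differences -/

namespace Causal

/-- By convexity, the exponential lies below its chord over `[-t, t]`. -/
theorem exp_mul_le_cosh_add {x t : ℝ} (hx : |x| ≤ 1) :
    Real.exp (t * x) ≤ Real.cosh t + x * Real.sinh t := by
  obtain ⟨h1, h2⟩ := abs_le.1 hx
  have h := convexOn_exp.2 (Set.mem_univ t) (Set.mem_univ (-t))
    (by linarith : 0 ≤ (1 + x) / 2) (by linarith : 0 ≤ (1 - x) / 2) (by ring)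
  simp only [smul_eq_mul] at h
  rw [Real.cosh_eq, Real.sinh_eq]
  calc Real.exp (t * x) = Real.exp ((1 + x) / 2 * t + (1 - x) / 2 * -t) := by congr 1; ring
    _ ≤ _ := h
    _ = _ := by ring

variable {Ω : Type*} {m m0 : MeasurableSpace Ω} {μ : Measure Ω}

theorem integrable_exp_mul_of_abs_le [IsFiniteMeasure μ] {f : Ω → ℝ}
    (hf : AEStronglyMeasurable f μ) {B : ℝ} (hB : ∀ᵐ ω ∂μ, |f ω| ≤ B) (t : ℝ) :
    Integrable (fun ω => Real.exp (t * f ω)) μ := by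
  refine integrable_of_abs_le
    ((Real.continuous_exp.comp (continuous_const_mul t)).comp_aestronglyMeasurable hf)
    (B := Real.exp (|t| * B)) ?_
  filter_upwards [hB] with ω h
  rw [Real.abs_exp, Real.exp_le_exp]
  exact (le_abs_self _).trans (by rw [abs_mul]; gcongr)

/-- One step of the Azuma–Hoeffding inequality. -/
theorem integral_exp_mul_add_le [IsProbabilityMeasure μ] (hm : m ≤ m0) {Y D : Ω → ℝ}
    (hY : StronglyMeasurable[m] Y) (hD : AEStronglyMeasurable D μ) {B B' : ℝ} (hB : 0 < B)
    (hYB : ∀ᵐ ω ∂μ, |Y ω| ≤ B') (hDB : ∀ᵐ ω ∂μ, |D ω| ≤ B) (h0 : μ[D | m] =ᵐ[μ] 0) (t : ℝ) :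
    ∫ ω, Real.exp (t * (Y ω + D ω)) ∂μ
      ≤ Real.exp ((t * B) ^ 2 / 2) * ∫ ω, Real.exp (t * Y ω) ∂μ := by
  have hYm := (hY.mono hm).aestronglyMeasurable (μ := μ)
  have hexp := integrable_exp_mul_of_abs_le hYm hYB t
  have hexpm : StronglyMeasurable[m] fun ω => Real.exp (t * Y ω) :=
    (Real.continuous_exp.comp (continuous_const_mul t)).comp_stronglyMeasurable hY
  have hexpD : Integrable ((fun ω => Real.exp (t * Y ω)) * D) μ :=
    hexp.mul_bdd hD (by simpa only [Real.norm_eq_abs] using hDB)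
  have hcross := integral_mul_eq_zero_of_condExp_eq_zero hm hexpm hexpD
    (integrable_of_abs_le hD hDB) h0
  have hexpD' : Integrable (fun ω => Real.sinh (t * B) / B * (Real.exp (t * Y ω) * D ω)) μ :=
    hexpD.const_mul _
  have hsum := integrable_exp_mul_of_abs_le (f := fun ω => Y ω + D ω) (B := B' + B)
    (hYm.add hD) (by
      filter_upwards [hYB, hDB] with ω h1 h2
      exact (abs_add_le _ _).trans (add_le_add h1 h2)) t
  calc ∫ ω, Real.exp (t * (Y ω + D ω)) ∂μ
      ≤ ∫ ω, (Real.cosh (t * B) * Real.exp (t * Y ω)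
          + Real.sinh (t * B) / B * (Real.exp (t * Y ω) * D ω)) ∂μ := by
        refine integral_mono_ae hsum ((hexp.const_mul _).add hexpD') ?_
        filter_upwards [hDB] with ω h
        have hx : |D ω / B| ≤ 1 := by rwa [abs_div, abs_of_pos hB, div_le_one hB]
        have h1 := exp_mul_le_cosh_add (t := t * B) hx
        rw [mul_assoc, mul_div_cancel₀ _ hB.ne'] at h1
        calc Real.exp (t * (Y ω + D ω)) = Real.exp (t * D ω) * Real.exp (t * Y ω) := by
              rw [← Real.exp_add]; congr 1; ring
          _ ≤ _ := mul_le_mul_of_nonneg_right h1 (Real.exp_pos _).le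
          _ = _ := by ring
    _ = Real.cosh (t * B) * ∫ ω, Real.exp (t * Y ω) ∂μ := by
        rw [integral_add (hexp.const_mul _) hexpD', integral_const_mul, integral_const_mul,
          hcross, mul_zero, add_zero]
    _ ≤ _ := mul_le_mul_of_nonneg_right (Real.cosh_le_exp_half_sq _)
        (integral_nonneg fun ω => (Real.exp_pos _).le)

/-- The Azuma–Hoeffding bound for the moment generating function. -/
theorem integral_exp_mul_sum_le [IsProbabilityMeasure μ]
    {𝒢 : ℕ → MeasurableSpace Ω} (h𝒢 : ∀ i, 𝒢 i ≤ m0) (hmono : Monotone 𝒢) {D : ℕ → Ω → ℝ}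
    (hD : ∀ i, StronglyMeasurable[𝒢 (i + 1)] (D i)) {B : ℝ} (hB0 : 0 < B)
    (hB : ∀ i, ∀ᵐ ω ∂μ, |D i ω| ≤ B) (h0 : ∀ i, μ[D i | 𝒢 i] =ᵐ[μ] 0) (t : ℝ) (n : ℕ) :
    ∫ ω, Real.exp (t * ∑ i ∈ Finset.range n, D i ω) ∂μ ≤ Real.exp (n * ((t * B) ^ 2 / 2)) := by
  induction n with
  | zero => simp
  | succ n ih =>
    have hS : StronglyMeasurable[𝒢 n] fun ω => ∑ i ∈ Finset.range n, D i ω :=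
      Finset.stronglyMeasurable_fun_sum _ fun i hi =>
        (hD i).mono (hmono (Finset.mem_range.1 hi))
    have h := integral_exp_mul_add_le (h𝒢 n) hS ((hD n).mono (h𝒢 _)).aestronglyMeasurable hB0
      (abs_sum_range_le_of_ae hB n) (hB n) (h0 n) t
    simp only [Finset.sum_range_succ]
    refine h.trans ((mul_le_mul_of_nonneg_left ih (Real.exp_pos _).le).trans (le_of_eq ?_))
    rw [← Real.exp_add]
    congr 1
    push_cast
    ring

theorem sum_range_mul_eq (k q : ℕ) (a : ℕ → ℝ) :
    ∑ i ∈ Finset.range (k * q), a i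
      = ∑ r ∈ Finset.range k, ∑ j ∈ Finset.range q, a (r + k * j) := by
  rw [Finset.sum_comm]
  induction q with
  | zero => simp
  | succ q ih =>
    rw [Nat.mul_succ, Finset.sum_range_add, ih, Finset.sum_range_succ]
    simp only [add_comm]

/-- The moment generating function of a sum of `k`-step martingale differences. -/
theorem integral_exp_mul_sum_le_of_step [IsProbabilityMeasure μ]
    {𝒢 : ℕ → MeasurableSpace Ω} (h𝒢 : ∀ i, 𝒢 i ≤ m0) (hmono : Monotone 𝒢) {k : ℕ} (hk : 0 < k)
    {D : ℕ → Ω → ℝ} (hD : ∀ i, StronglyMeasurable[𝒢 (i + k)] (D i)) {B : ℝ} (hB0 : 0 < B)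
    (hB : ∀ i, ∀ᵐ ω ∂μ, |D i ω| ≤ B) (h0 : ∀ i, μ[D i | 𝒢 i] =ᵐ[μ] 0) (t : ℝ) (q : ℕ) :
    ∫ ω, Real.exp (t * ∑ i ∈ Finset.range (k * q), D i ω) ∂μ
      ≤ Real.exp (q * ((t * k * B) ^ 2 / 2)) := by
  have hk' : (0 : ℝ) < k := Nat.cast_pos.2 hk
  -- Along one residue class mod `k` the summands are ordinary martingale differences for the
  -- σ-algebras `𝒢 (r + k * j)`.
  set Z : ℕ → Ω → ℝ := fun r ω => ∑ j ∈ Finset.range q, D (r + k * j) ω with hZ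
  have hZint : ∀ r, Integrable (fun ω => Real.exp (t * k * Z r ω)) μ := fun r =>
    integrable_exp_mul_of_abs_le (Finset.stronglyMeasurable_fun_sum _ fun j _ =>
      (hD (r + k * j)).mono (h𝒢 _)).aestronglyMeasurable
      (abs_sum_range_le_of_ae (fun j => hB (r + k * j)) q) _
  have hZle : ∀ r, ∫ ω, Real.exp (t * k * Z r ω) ∂μ ≤ Real.exp (q * ((t * k * B) ^ 2 / 2)) :=
    fun r => integral_exp_mul_sum_le (𝒢 := fun j => 𝒢 (r + k * j)) (fun j => h𝒢 _)
      (fun i j hij => hmono (by gcongr)) (D := fun j => D (r + k * j))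
      (fun j => (hD (r + k * j)).mono (hmono (by rw [mul_add, mul_one, add_assoc]))) hB0
      (fun j => hB _) (fun j => h0 _) _ q
  calc ∫ ω, Real.exp (t * ∑ i ∈ Finset.range (k * q), D i ω) ∂μ
      ≤ ∫ ω, ∑ r ∈ Finset.range k, (k : ℝ)⁻¹ * Real.exp (t * k * Z r ω) ∂μ := by
        refine integral_mono ?_ (integrable_finsetSum _ fun r _ => (hZint r).const_mul _)
          fun ω => ?_
        · exact integrable_exp_mul_of_abs_le (Finset.stronglyMeasurable_fun_sum _ fun j _ =>
            (hD j).mono (h𝒢 _)).aestronglyMeasurable (abs_sum_range_le_of_ae hB _) _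
        -- Jensen: the whole sum is the average over `r` of `k * Z r`. No independence between
        -- residue classes is needed.
        · have h := convexOn_exp.map_sum_le (t := Finset.range k) (w := fun _ => (k : ℝ)⁻¹)
            (p := fun r => t * k * Z r ω) (fun _ _ => by positivity)
            (by simp [hk'.ne']) (fun _ _ => Set.mem_univ _)
          simp only [smul_eq_mul] at h
          refine le_trans (le_of_eq ?_) h
          simp only [sum_range_mul_eq, hZ, Finset.mul_sum]
          congr 1
          refine Finset.sum_congr rfl fun r _ => Finset.sum_congr rfl fun j _ => ?_
          field_simp
    _ = ∑ r ∈ Finset.range k, (k : ℝ)⁻¹ * ∫ ω, Real.exp (t * k * Z r ω) ∂μ := by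
        rw [integral_finsetSum _ fun r _ => (hZint r).const_mul _]
        simp only [integral_const_mul]
    _ ≤ ∑ _r ∈ Finset.range k, (k : ℝ)⁻¹ * Real.exp (q * ((t * k * B) ^ 2 / 2)) := by
        gcongr with r
        exact hZle r
    _ = _ := by
        rw [Finset.sum_const, Finset.card_range, nsmul_eq_mul, ← mul_assoc,
          mul_inv_cancel₀ hk'.ne', one_mul]

theorem measure_sum_ge_le_of_step [IsProbabilityMeasure μ]
    {𝒢 : ℕ → MeasurableSpace Ω} (h𝒢 : ∀ i, 𝒢 i ≤ m0) (hmono : Monotone 𝒢) {k : ℕ} (hk : 0 < k)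
    {D : ℕ → Ω → ℝ} (hD : ∀ i, StronglyMeasurable[𝒢 (i + k)] (D i)) {B : ℝ} (hB0 : 0 < B)
    (hB : ∀ i, ∀ᵐ ω ∂μ, |D i ω| ≤ B) (h0 : ∀ i, μ[D i | 𝒢 i] =ᵐ[μ] 0) {q : ℕ} (hq : 0 < q)
    {x : ℝ} (hx : 0 ≤ x) :
    μ.real {ω | x ≤ ∑ i ∈ Finset.range (k * q), D i ω}
      ≤ Real.exp (-(x ^ 2 / (2 * q * (k * B) ^ 2))) := by
  have hk' : (0 : ℝ) < k := Nat.cast_pos.2 hk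
  have hq' : (0 : ℝ) < q := Nat.cast_pos.2 hq
  -- The minimiser of the Chernoff exponent `-t * x + q * (t * k * B) ^ 2 / 2`.
  set t : ℝ := x / (q * (k * B) ^ 2) with ht
  have hfi := integrable_exp_mul_of_abs_le (Finset.stronglyMeasurable_fun_sum _ fun j _ =>
    (hD j).mono (h𝒢 _)).aestronglyMeasurable (abs_sum_range_le_of_ae hB (k * q)) t
  refine (measure_ge_le_exp_mul_mgf x (by positivity : 0 ≤ t) hfi).trans ?_
  have h := integral_exp_mul_sum_le_of_step h𝒢 hmono hk hD hB0 hB h0 t q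
  refine (mul_le_mul_of_nonneg_left h (Real.exp_pos _).le).trans (le_of_eq ?_)
  rw [← Real.exp_add]
  congr 1
  rw [ht]
  field_simp
  ring

/-- The Azuma–Hoeffding inequality for `k`-step martingale differences. -/
theorem measure_abs_sum_ge_le_of_step [IsProbabilityMeasure μ]
    {𝒢 : ℕ → MeasurableSpace Ω} (h𝒢 : ∀ i, 𝒢 i ≤ m0) (hmono : Monotone 𝒢) {k : ℕ} (hk : 0 < k)
    {D : ℕ → Ω → ℝ} (hD : ∀ i, StronglyMeasurable[𝒢 (i + k)] (D i)) {B : ℝ} (hB0 : 0 < B)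
    (hB : ∀ i, ∀ᵐ ω ∂μ, |D i ω| ≤ B) (h0 : ∀ i, μ[D i | 𝒢 i] =ᵐ[μ] 0) {n q : ℕ} (hq : 0 < q)
    (hn : n ≤ k * q) {x : ℝ} (hx : 0 ≤ x) :
    μ {ω | x ≤ |∑ i ∈ Finset.range n, D i ω|}
      ≤ ENNReal.ofReal (2 * Real.exp (-(x ^ 2 / (2 * q * (k * B) ^ 2)))) := by
  have hside : ∀ s : ℝ, |s| = 1 →
      μ.real {ω | x ≤ ∑ i ∈ Finset.range n, s * D i ω}
        ≤ Real.exp (-(x ^ 2 / (2 * q * (k * B) ^ 2))) := fun s hs => by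
    -- Since `n` need not be a multiple of `k`, the sequence is padded with zeros up to `k * q`.
    have h := measure_sum_ge_le_of_step (μ := μ) h𝒢 hmono hk
      (D := fun i ω => (if i < n then s else 0) * D i ω)
      (fun i => stronglyMeasurable_const.mul (hD i)) hB0 (fun i => ?_) (fun i => ?_) hq hx
    · refine le_trans (le_of_eq ?_) h
      congr 2
      ext ω
      rw [← Finset.sum_subset (Finset.range_subset_range.2 hn) (fun i _ hi => by
        rw [if_neg (by simpa using hi), zero_mul])]
      exact iff_of_eq (congrArg _ (Finset.sum_congr rfl fun i hi => by
        rw [if_pos (Finset.mem_range.1 hi)]))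
    · filter_upwards [hB i] with ω h
      rw [abs_mul]
      split_ifs
      · rwa [hs, one_mul]
      · rw [abs_zero, zero_mul]
        exact hB0.le
    · filter_upwards [condExp_smul (if i < n then s else 0) (D i) (𝒢 i), h0 i] with ω h1 h2
      refine h1.trans ?_
      rw [Pi.smul_apply, h2]
      simp
  have hsub : {ω | x ≤ |∑ i ∈ Finset.range n, D i ω|}
      ⊆ {ω | x ≤ ∑ i ∈ Finset.range n, 1 * D i ω}
        ∪ {ω | x ≤ ∑ i ∈ Finset.range n, -1 * D i ω} := fun ω hω => by
    simpa only [Set.mem_union, Set.mem_ofPred_eq, ← Finset.mul_sum, one_mul, neg_one_mul, le_abs,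
      Finset.sum_neg_distrib]
      using hω
  rw [← ofReal_measureReal]
  refine ENNReal.ofReal_le_ofReal ((measureReal_mono hsub).trans ((measureReal_union_le _ _).trans ?_))
  rw [two_mul]
  exact add_le_add (hside 1 (by simp)) (hside (-1) (by simp))

end Causal

/-! ### Resampling one independent coordinate -/

namespace Causal

variable {Ω α β γ : Type*} [MeasurableSpace Ω] [MeasurableSpace α] [MeasurableSpace β]
  [MeasurableSpace γ] {μ : Measure Ω}

theorem setIntegral_preimage_eq_integral_mul {ν : Measure α} {φ : α → β} (hφ : Measurable φ)
    {A : Set β} (hA : MeasurableSet A) (f : α → ℝ) :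
    ∫ x in φ ⁻¹' A, f x ∂ν = ∫ x, A.indicator (fun _ => (1 : ℝ)) (φ x) * f x ∂ν := by
  rw [← integral_indicator (hφ hA)]
  congr 1
  ext x
  by_cases hx : φ x ∈ A <;> simp [Set.indicator, hx]

theorem map_prodMk_eq_of_indepFun [IsProbabilityMeasure μ] {U : Ω → α} {v : Ω → β}
    (hU : Measurable U) (hv : Measurable v) (h : IndepFun U v μ) :
    (μ.prod μ).map (fun p : Ω × Ω => (U p.1, v p.2)) = μ.map fun ω => (U ω, v ω) := by
  rw [(indepFun_iff_map_prod_eq_prod_map_map hU.aemeasurable hv.aemeasurable).1 h,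
    Measure.map_prod_map _ _ hU hv]
  rfl

/-- Exchangeability of a variable and its independent copy. -/
theorem map_swap_copy_eq [IsProbabilityMeasure μ] {U : Ω → α} {v : Ω → β}
    (hU : Measurable U) (hv : Measurable v) (h : IndepFun U v μ) :
    (μ.prod μ).map (fun p : Ω × Ω => (U p.1, v p.1, v p.2))
      = (μ.prod μ).map fun p : Ω × Ω => (U p.1, v p.2, v p.1) := by
  have := Measure.isProbabilityMeasure_map (μ := μ) hU.aemeasurable
  have := Measure.isProbabilityMeasure_map (μ := μ) hv.aemeasurable
  have h1 : (μ.prod μ).map (fun p : Ω × Ω => (U p.1, v p.1, v p.2))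
      = (μ.map U).prod ((μ.map v).prod (μ.map v)) := by
    have e : (fun p : Ω × Ω => (U p.1, v p.1, v p.2))
        = MeasurableEquiv.prodAssoc ∘ Prod.map (fun ω => (U ω, v ω)) v := rfl
    rw [e, ← Measure.map_map MeasurableEquiv.prodAssoc.measurable ((hU.prodMk hv).prodMap hv),
      ← Measure.map_prod_map _ _ (hU.prodMk hv) hv,
      (indepFun_iff_map_prod_eq_prod_map_map hU.aemeasurable hv.aemeasurable).1 h,
      (measurePreserving_prodAssoc _ _ _).map_eq]
  have h2 : (fun p : Ω × Ω => (U p.1, v p.2, v p.1))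
      = Prod.map id Prod.swap ∘ fun p : Ω × Ω => (U p.1, v p.1, v p.2) := rfl
  rw [h2, ← Measure.map_map (measurable_id.prodMap measurable_swap) (by fun_prop), h1,
    ← Measure.map_prod_map _ _ measurable_id measurable_swap, Measure.map_id, Measure.prod_swap]

/-- In other words, `F(U, v')` given `(π(U), v)` has the conditional expectation of `F(U, v)` given
`π(U)`. Swap `v` with its copy, freeze the copy by Fubini and condition on `π(U)`; then replace the
copy by `v`, since both have the same joint law with `π(U)`. -/
theorem setIntegral_copy_eq [IsProbabilityMeasure μ] {U : Ω → α} {v : Ω → β}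
    (hU : Measurable U) (hv : Measurable v) (h : IndepFun U v μ) {F : α × β → ℝ}
    (hF : Measurable F) (hfi : Integrable (fun ω => F (U ω, v ω)) μ) {π : α → γ}
    (hπ : Measurable π) {A : Set (γ × β)} (hA : MeasurableSet A) :
    ∫ p in (fun p : Ω × Ω => (π (U p.1), v p.1)) ⁻¹' A, F (U p.1, v p.2) ∂(μ.prod μ)
      = ∫ ω in (fun ω => (π (U ω), v ω)) ⁻¹' A,
        (μ[fun ω => F (U ω, v ω) | MeasurableSpace.comap (fun ω => π (U ω)) inferInstance]) ω ∂μ := by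
  set X : Ω → ℝ := fun ω => F (U ω, v ω) with hX
  have hW : Measurable fun ω => π (U ω) := hπ.comp hU
  obtain ⟨y, hy, hYy⟩ := Measurable.exists_eq_measurable_comp (f := fun ω => π (U ω))
    (stronglyMeasurable_condExp (μ := μ) (f := X)
      (m := MeasurableSpace.comap (fun ω => π (U ω)) inferInstance)).measurable
  set Y : Ω → ℝ := μ[X | MeasurableSpace.comap (fun ω => π (U ω)) inferInstance] with hY
  set χ : γ × β → ℝ := A.indicator fun _ => (1 : ℝ) with hχ
  have hχm : Measurable χ := measurable_const.indicator hA
  have hχle : ∀ z, ‖χ z‖ ≤ 1 := fun z => by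
    by_cases hz : z ∈ A <;> simp [hχ, hz]
  have hYint : Integrable Y μ := integrable_condExp
  have hcut : ∀ {f : Ω → ℝ}, Integrable f μ →
      Integrable (fun p : Ω × Ω => χ (π (U p.1), v p.2) * f p.1) (μ.prod μ) := fun {f} hf =>
    (hf.comp_fst μ).bdd_mul (c := 1) (by fun_prop : Measurable _).aestronglyMeasurable
      (Eventually.of_forall fun p => hχle _)
  have hΦ : Measurable fun z : α × β × β => χ (π z.1, z.2.1) * F (z.1, z.2.2) := by fun_prop
  have hΨ : Measurable fun z : γ × β => χ z * y z.1 := by fun_prop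
  calc ∫ p in (fun p : Ω × Ω => (π (U p.1), v p.1)) ⁻¹' A, F (U p.1, v p.2) ∂(μ.prod μ)
      = ∫ p : Ω × Ω, χ (π (U p.1), v p.1) * F (U p.1, v p.2) ∂(μ.prod μ) :=
        setIntegral_preimage_eq_integral_mul (by fun_prop) hA _
    _ = ∫ z, χ (π z.1, z.2.1) * F (z.1, z.2.2)
          ∂((μ.prod μ).map fun p : Ω × Ω => (U p.1, v p.1, v p.2)) :=
        (integral_map (φ := fun p : Ω × Ω => (U p.1, v p.1, v p.2)) (by fun_prop)
          hΦ.aestronglyMeasurable).symm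
    _ = ∫ p : Ω × Ω, χ (π (U p.1), v p.2) * X p.1 ∂(μ.prod μ) := by
        rw [map_swap_copy_eq hU hv h]
        exact integral_map (by fun_prop) hΦ.aestronglyMeasurable
    _ = ∫ ω', ∫ ω, χ (π (U ω), v ω') * X ω ∂μ ∂μ := integral_prod_symm _ (hcut hfi)
    _ = ∫ ω', ∫ ω, χ (π (U ω), v ω') * Y ω ∂μ ∂μ := by
        congr 1
        ext ω'
        have hS : MeasurableSet ((fun c : γ => (c, v ω')) ⁻¹' A) :=
          (measurable_id.prodMk measurable_const) hA
        have h1 := setIntegral_condExp hW.comap_le hfi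
          (s := (fun ω => π (U ω)) ⁻¹' ((fun c : γ => (c, v ω')) ⁻¹' A)) ⟨_, hS, rfl⟩
        rw [setIntegral_preimage_eq_integral_mul hW hS,
          setIntegral_preimage_eq_integral_mul hW hS] at h1
        exact h1.symm
    _ = ∫ p : Ω × Ω, χ (π (U p.1), v p.2) * Y p.1 ∂(μ.prod μ) :=
        (integral_prod_symm _ (hcut hYint)).symm
    _ = ∫ z, χ z * y z.1 ∂((μ.prod μ).map fun p : Ω × Ω => (π (U p.1), v p.2)) := by
        rw [hYy]
        exact (integral_map (by fun_prop) hΨ.aestronglyMeasurable).symm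
    _ = ∫ ω, χ (π (U ω), v ω) * Y ω ∂μ := by
        rw [map_prodMk_eq_of_indepFun hW hv (h.comp hπ measurable_id), hYy]
        exact integral_map (by fun_prop) hΨ.aestronglyMeasurable
    _ = _ := (setIntegral_preimage_eq_integral_mul (by fun_prop) hA _).symm

/-- Removing one independent coordinate `v` from the conditioning moves a conditional expectation
in `L^p` by at most the effect of resampling `v`. -/
theorem eLpNorm_condExp_sub_condExp_le [IsProbabilityMeasure μ] {U : Ω → α} {v : Ω → β}
    (hU : Measurable U) (hv : Measurable v) (h : IndepFun U v μ) {F : α × β → ℝ}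
    (hF : Measurable F) (hfi : Integrable (fun ω => F (U ω, v ω)) μ) {π : α → γ}
    (hπ : Measurable π) {p : ℝ≥0∞} (hp : 1 ≤ p) :
    eLpNorm
      (μ[fun ω => F (U ω, v ω) | MeasurableSpace.comap (fun ω => (π (U ω), v ω)) inferInstance]
        - μ[fun ω => F (U ω, v ω) | MeasurableSpace.comap (fun ω => π (U ω)) inferInstance]) p μ
      ≤ eLpNorm (fun q : Ω × Ω => F (U q.1, v q.1) - F (U q.1, v q.2)) p (μ.prod μ) := by
  set X : Ω → ℝ := fun ω => F (U ω, v ω) with hX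
  have hWv : Measurable fun ω => (π (U ω), v ω) := by fun_prop
  have hW : Measurable fun ω => π (U ω) := by fun_prop
  set Z : Ω → ℝ := μ[X | MeasurableSpace.comap (fun ω => (π (U ω), v ω)) inferInstance] with hZ
  set Y : Ω → ℝ := μ[X | MeasurableSpace.comap (fun ω => π (U ω)) inferInstance] with hY
  set V : Ω × Ω → ℝ := fun q => F (U q.1, v q.1) - F (U q.1, v q.2) with hV
  have hℳm : Measurable fun q : Ω × Ω => (π (U q.1), v q.1) := by fun_prop
  have hZm : StronglyMeasurable[MeasurableSpace.comap (fun ω => (π (U ω), v ω)) inferInstance] Z :=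
    stronglyMeasurable_condExp
  have hYm : StronglyMeasurable[MeasurableSpace.comap (fun ω => (π (U ω), v ω)) inferInstance] Y :=
    (stronglyMeasurable_condExp (μ := μ) (f := X)).mono
      (measurable_iff_comap_le.1 (measurable_fst.comp (comap_measurable _)))
  have hZYint : Integrable (Z - Y) μ := integrable_condExp.sub integrable_condExp
  have hfst : (μ.prod μ).map Prod.fst = μ := measurePreserving_fst.map_eq
  have hcopy : Integrable (fun q : Ω × Ω => F (U q.1, v q.2)) (μ.prod μ) := by
    have h1 : Integrable F ((μ.prod μ).map fun q : Ω × Ω => (U q.1, v q.2)) := by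
      rw [map_prodMk_eq_of_indepFun hU hv h]
      exact (integrable_map_measure hF.aestronglyMeasurable (by fun_prop)).2 hfi
    exact (integrable_map_measure hF.aestronglyMeasurable (by fun_prop)).1 h1
  have hX1 : Integrable (fun q : Ω × Ω => X q.1) (μ.prod μ) := hfi.comp_fst μ
  have hpush : ∀ {f : Ω → ℝ}, AEStronglyMeasurable f μ → ∀ {S : Set Ω}, MeasurableSet S →
      ∫ q in Prod.fst ⁻¹' S, f q.1 ∂(μ.prod μ) = ∫ ω in S, f ω ∂μ := fun {f} hf S hS => by
    have h1 := setIntegral_map (μ := μ.prod μ) (g := Prod.fst) (f := f) hS (by rwa [hfst])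
      measurable_fst.aemeasurable
    rw [hfst] at h1
    exact h1.symm
  -- Lifted to the product space, the difference is a conditional expectation of the resampling
  -- effect `V`; contractivity in `L^p` then concludes.
  have key : (fun q : Ω × Ω => (Z - Y) q.1) =ᵐ[μ.prod μ] (μ.prod μ)[V |
      MeasurableSpace.comap (fun q : Ω × Ω => (π (U q.1), v q.1)) inferInstance] := by
    refine ae_eq_condExp_of_forall_setIntegral_eq hℳm.comap_le (hX1.sub hcopy)
      (fun s _ _ => (hZYint.comp_fst μ).integrableOn) ?_ ?_
    · rintro s ⟨A, hA, rfl⟩ -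
      have hS := hWv hA
      have h1 : ∫ q in (fun q : Ω × Ω => (π (U q.1), v q.1)) ⁻¹' A, (Z - Y) q.1 ∂(μ.prod μ)
          = ∫ ω in (fun ω => (π (U ω), v ω)) ⁻¹' A, (Z - Y) ω ∂μ :=
        hpush hZYint.aestronglyMeasurable hS
      have h2 : ∫ q in (fun q : Ω × Ω => (π (U q.1), v q.1)) ⁻¹' A, X q.1 ∂(μ.prod μ)
          = ∫ ω in (fun ω => (π (U ω), v ω)) ⁻¹' A, X ω ∂μ :=
        hpush hfi.aestronglyMeasurable hS
      have h3 : ∫ ω in (fun ω => (π (U ω), v ω)) ⁻¹' A, Z ω ∂μ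
          = ∫ ω in (fun ω => (π (U ω), v ω)) ⁻¹' A, X ω ∂μ :=
        setIntegral_condExp hWv.comap_le hfi ⟨A, hA, rfl⟩
      have h4 := setIntegral_copy_eq hU hv h hF hfi hπ hA
      rw [h1]
      simp only [Pi.sub_apply]
      rw [integral_sub integrable_condExp.integrableOn integrable_condExp.integrableOn, h3, ← h4,
        ← h2]
      exact (integral_sub hX1.integrableOn hcopy.integrableOn).symm
    · refine StronglyMeasurable.aestronglyMeasurable ?_
      refine (hZm.sub hYm).comp_measurable ?_
      rw [measurable_iff_comap_le, MeasurableSpace.comap_comp]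
      exact le_rfl
  calc eLpNorm (Z - Y) p μ = eLpNorm (Z - Y) p ((μ.prod μ).map Prod.fst) := by rw [hfst]
    _ = eLpNorm (fun q : Ω × Ω => (Z - Y) q.1) p (μ.prod μ) :=
        eLpNorm_map_measure (by rw [hfst]; exact hZYint.aestronglyMeasurable)
          measurable_fst.aemeasurable
    _ = eLpNorm ((μ.prod μ)[V |
      MeasurableSpace.comap (fun q : Ω × Ω => (π (U q.1), v q.1)) inferInstance]) p (μ.prod μ) := eLpNorm_congr_ae key
    _ ≤ eLpNorm V p (μ.prod μ) := eLpNorm_condExp_le_eLpNorm _ hp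

end Causal

/-! ### Future σ-algebras of the innovations and the coupling norm -/

namespace Causal

variable {Ω E : Type*} [MeasurableSpace E] {ε : ℤ → Ω → E} {g : ℤ → (ℕ → E) → ℝ}

/-- The innovations with times in `S`. -/
def block (ε : ℤ → Ω → E) (S : Set ℤ) (ω : Ω) : S → E := fun u => ε u ω

/-- The σ-algebra generated by the innovations from time `s` on. -/
abbrev futureSigma (ε : ℤ → Ω → E) (s : ℤ) : MeasurableSpace Ω :=
  MeasurableSpace.comap (block ε (Set.Ici s)) inferInstance

theorem measurable_comap_block {S : Set ℤ} {u : ℤ} (hu : u ∈ S) :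
    Measurable[MeasurableSpace.comap (block ε S) inferInstance] (ε u) :=
  (measurable_pi_apply (⟨u, hu⟩ : S)).comp (comap_measurable (block ε S))

theorem comap_block_le_iff {S : Set ℤ} {𝒜 : MeasurableSpace Ω} :
    MeasurableSpace.comap (block ε S) inferInstance ≤ 𝒜 ↔ ∀ u ∈ S, Measurable[𝒜] (ε u) := by
  rw [← measurable_iff_comap_le, measurable_pi_iff]
  exact ⟨fun h u hu => h ⟨u, hu⟩, fun h u => h u u.2⟩

theorem futureSigma_anti : Antitone (futureSigma ε) := fun _ _ hst =>
  comap_block_le_iff.2 fun _ hu => measurable_comap_block (hst.trans hu)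

theorem measurable_past {𝒜 : MeasurableSpace Ω} {t : ℤ} (h : ∀ u ≤ t, Measurable[𝒜] (ε u)) :
    Measurable[𝒜] (past ε t) :=
  measurable_pi_lambda _ fun j => h _ (by omega)

theorem stronglyMeasurable_proc {𝒜 : MeasurableSpace Ω} (hg : ∀ t, Measurable (g t)) {t : ℤ}
    (h : ∀ u ≤ t, Measurable[𝒜] (ε u)) : StronglyMeasurable[𝒜] (proc g ε t) :=
  ((hg t).comp (measurable_past h)).stronglyMeasurable

variable [MeasurableSpace Ω] {μ : Measure Ω}

theorem measurable_block (hε : ∀ t, Measurable (ε t)) (S : Set ℤ) : Measurable (block ε S) :=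
  measurable_pi_lambda _ fun u => hε u

theorem futureSigma_le (hε : ∀ t, Measurable (ε t)) (s : ℤ) :
    futureSigma ε s ≤ ‹MeasurableSpace Ω› :=
  comap_block_le_iff.2 fun u _ => hε u

theorem IsIID.indepFun_block (hε : IsIID μ ε) {S T : Set ℤ} (hST : Disjoint S T) :
    IndepFun (block ε S) (block ε T) μ := by
  have h := indep_iSup_of_disjoint (m := fun u => MeasurableSpace.comap (ε u) inferInstance)
    (fun u => (hε.measurable u).comap_le) hε.indep hST
  have hle : ∀ R : Set ℤ, MeasurableSpace.comap (block ε R) inferInstance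
      ≤ ⨆ u ∈ R, MeasurableSpace.comap (ε u) inferInstance := fun R =>
    comap_block_le_iff.2 fun u hu => measurable_iff_comap_le.2
      (le_iSup₂ (f := fun u (_ : u ∈ R) => MeasurableSpace.comap (ε u) inferInstance) u hu)
  exact indep_of_indep_of_le_left (indep_of_indep_of_le_right h (hle T)) (hle S)

theorem condExp_proc_future_eq_zero [IsProbabilityMeasure μ] (hε : IsIID μ ε)
    (hg : ∀ t, Measurable (g t)) {t : ℤ} (h0 : ∫ ω, proc g ε t ω ∂μ = 0) :
    μ[proc g ε t | futureSigma ε (t + 1)] =ᵐ[μ] 0 := by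
  have hind := hε.indepFun_block (S := Set.Iic t) (T := Set.Ici (t + 1)) <| by
    rw [Set.disjoint_left]
    intro u hu hu'
    simp only [Set.mem_Iic, Set.mem_Ici] at hu hu'
    omega
  have h := condExp_indep_eq (measurable_block hε.measurable (Set.Iic t)).comap_le
    (futureSigma_le hε.measurable (t + 1))
    (stronglyMeasurable_proc hg fun u hu => measurable_comap_block hu) hind
  filter_upwards [h] with ω hω
  rw [hω, h0]
  rfl

/-- The resampling bound with `v` the innovation at time `s = t - ℓ`, `U` all other innovations and
`π` the restriction to times after `s`. -/
theorem eLpNorm_condExp_sub_le_couplingNorm [IsProbabilityMeasure μ] (hε : IsIID μ ε)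
    (hg : ∀ t, Measurable (g t)) {d : ℝ} (hd : 1 ≤ d) {t : ℤ}
    (hfi : Integrable (proc g ε t) μ) (ℓ : ℕ) :
    eLpNorm (μ[proc g ε t | futureSigma ε (t - ℓ)] - μ[proc g ε t | futureSigma ε (t - ℓ + 1)])
      (ENNReal.ofReal d) μ ≤ couplingNorm μ g ε d ℓ t := by
  set s : ℤ := t - ℓ with hs
  set S : Set ℤ := {s}ᶜ with hS
  have hmem : ∀ {j : ℕ}, j ≠ ℓ → t - (j : ℤ) ∈ S := fun {j} hj => by
    simp only [hS, hs, Set.mem_compl_iff, Set.mem_singleton_iff]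
    omega
  have hfut : ∀ u : Set.Ici (s + 1), (u : ℤ) ∈ S := fun u => by
    have := u.2
    simp only [Set.mem_Ici] at this
    simp only [hS, Set.mem_compl_iff, Set.mem_singleton_iff]
    omega
  have hv : IndepFun (block ε S) (ε s) μ :=
    (hε.indepFun_block (S := S) (T := {s}) disjoint_compl_left).comp (φ := id)
      (ψ := fun x : ({s} : Set ℤ) → E => x ⟨s, Set.mem_singleton s⟩)
      measurable_id (measurable_pi_apply (⟨s, Set.mem_singleton s⟩ : ({s} : Set ℤ)))
  set F : (S → E) × E → ℝ := fun x => g t fun j =>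
    if h : j = ℓ then x.2 else x.1 ⟨t - (j : ℤ), hmem h⟩ with hF
  have hFm : Measurable F := by
    refine (hg t).comp (measurable_pi_lambda _ fun j => ?_)
    by_cases h : j = ℓ
    · simp only [h, dite_true]
      exact measurable_snd
    · simp only [h, dite_false]
      exact (measurable_pi_apply _).comp measurable_fst
  set π : (S → E) → (Set.Ici (s + 1) → E) := fun x u => x ⟨u, hfut u⟩ with hπ
  have hπm : Measurable π := measurable_pi_lambda _ fun u => measurable_pi_apply _
  have hX : (fun ω => F (block ε S ω, ε s ω)) = proc g ε t := by
    ext ω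
    simp only [hF, proc]
    congr 1
    ext j
    by_cases h : j = ℓ
    · simp only [h, dite_true, past, hs]
    · simp only [h, dite_false, past, block]
  have hcopy : ∀ q : Ω × Ω, F (block ε S q.1, ε s q.2) = coupled g ε ℓ t q := fun q => by
    simp only [hF, coupled]
    congr 1
    ext j
    by_cases h : j = ℓ
    · subst h
      simp only [dite_true, Function.update_self, hs]
    · simp only [h, dite_false, Function.update_of_ne, past, block, ne_eq, not_false_eq_true]
  have hσ : MeasurableSpace.comap (fun ω => (π (block ε S ω), ε s ω)) inferInstance
      = futureSigma ε s := by
    refine le_antisymm ?_ (comap_block_le_iff.2 fun u hu => ?_)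
    · refine measurable_iff_comap_le.1 (Measurable.prodMk ?_ (measurable_comap_block (Set.mem_Ici.2 le_rfl)))
      refine @measurable_pi_lambda _ _ _ (futureSigma ε s) _ _ fun u => measurable_comap_block ?_
      have := u.2
      simp only [Set.mem_Ici] at this ⊢
      omega
    · rcases eq_or_ne u s with rfl | hne
      · exact measurable_snd.comp (comap_measurable _)
      · have hu' : u ∈ Set.Ici (s + 1) := by
          simp only [Set.mem_Ici] at hu ⊢
          omega
        exact (measurable_pi_apply (⟨u, hu'⟩ : Set.Ici (s + 1))).comp
          (measurable_fst.comp (comap_measurable fun ω => (π (block ε S ω), ε s ω)))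
  have hmain := eLpNorm_condExp_sub_condExp_le (measurable_block hε.measurable S)
    (hε.measurable s) hv hFm (by rw [hX]; exact hfi) hπm (p := ENNReal.ofReal d)
    (by rwa [ENNReal.one_le_ofReal])
  rw [hσ, hX] at hmain
  refine hmain.trans (le_of_eq ?_)
  unfold couplingNorm
  congr 1
  ext q
  rw [hcopy q, ← hX]

end Causal

/-! ### Tail bound along an abstract filtration -/

namespace Causal

variable {Ω : Type*} {m0 : MeasurableSpace Ω} {μ : Measure Ω}

/-- The error of replacing `x i` by its conditional expectation given `ℱ (i + m)`, summed over `i`,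
in terms of the sizes `θ ℓ` of the increments of these conditional expectations. -/
theorem eLpNorm_sum_sub_condExp_le [IsProbabilityMeasure μ] {p : ℝ} (hp : 2 < p)
    (ℱ : Filtration ℕ m0) {x : ℕ → Ω → ℝ} (hx : ∀ i, StronglyMeasurable[⨆ k, ℱ k] (x i)) {B : ℝ}
    (hB : ∀ i, ∀ᵐ ω ∂μ, |x i ω| ≤ B) {θ : ℕ → ℝ≥0∞}
    (hθ : ∀ i ℓ, eLpNorm (μ[x i | ℱ (i + ℓ + 1)] - μ[x i | ℱ (i + ℓ)]) (ENNReal.ofReal p) μ ≤ θ ℓ)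
    (m n : ℕ) :
    eLpNorm (fun ω => ∑ i ∈ Finset.range n, (x i ω - (μ[x i | ℱ (i + m)]) ω)) (ENNReal.ofReal p) μ
      ≤ ENNReal.ofReal (√(2 * (p ^ 2 * 2 ^ p)) * √n) * ∑' j, θ (m + j) := by
  set c := ENNReal.ofReal (√(2 * (p ^ 2 * 2 ^ p)) * √n) with hc
  have hle : ⨆ k, ℱ k ≤ m0 := iSup_le ℱ.le
  have hfi : ∀ i, Integrable (x i) μ := fun i =>
    integrable_of_abs_le ((hx i).mono hle).aestronglyMeasurable (hB i)
  -- For fixed `ℓ`, these are martingale differences in `i` with respect to `ℱ (i + ℓ)`; the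
  -- remainder is their sum over `ℓ ≥ m`.
  set D : ℕ → ℕ → Ω → ℝ := fun ℓ i => μ[x i | ℱ (i + ℓ + 1)] - μ[x i | ℱ (i + ℓ)] with hD
  have hDm : ∀ ℓ i, StronglyMeasurable[ℱ (i + ℓ + 1)] (D ℓ i) := fun ℓ i =>
    stronglyMeasurable_condExp.sub (stronglyMeasurable_condExp.mono (ℱ.mono (Nat.le_succ _)))
  have hDsm : ∀ ℓ, AEStronglyMeasurable (fun ω => ∑ i ∈ Finset.range n, D ℓ i ω) μ := fun ℓ =>
    (Finset.stronglyMeasurable_fun_sum _ fun i _ =>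
      (hDm ℓ i).mono (ℱ.le _)).aestronglyMeasurable
  have hDsum : ∀ ℓ, eLpNorm (fun ω => ∑ i ∈ Finset.range n, D ℓ i ω) (ENNReal.ofReal p) μ
      ≤ c * θ ℓ := fun ℓ => by
    refine eLpNorm_martingale_sum_le hp (𝒢 := fun i => ℱ (i + ℓ)) (fun i => ℱ.le _)
      (fun i j hij => ℱ.mono (by gcongr)) (D := D ℓ)
      (fun i => by
        rw [add_right_comm]
        exact hDm ℓ i) (B := B + B) (fun i => ?_)
      (fun i => ?_) n fun i _ => hθ i ℓ
    · filter_upwards [ae_bdd_abs_condExp_of_ae_bdd_abs (m := ℱ (i + ℓ + 1)) (hB i),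
        ae_bdd_abs_condExp_of_ae_bdd_abs (m := ℱ (i + ℓ)) (hB i)] with ω h1 h2
      exact (abs_sub _ _).trans (add_le_add h1 h2)
    · have h1 := condExp_sub (μ := μ) (integrable_condExp (f := x i) (m := ℱ (i + ℓ + 1)))
        (integrable_condExp (f := x i) (m := ℱ (i + ℓ))) (ℱ (i + ℓ))
      have h2 := condExp_condExp_of_le (μ := μ) (f := x i)
        (ℱ.mono (Nat.le_succ (i + ℓ))) (ℱ.le (i + ℓ + 1))
      have h3 := condExp_condExp_of_le (μ := μ) (f := x i) (le_refl (ℱ (i + ℓ))) (ℱ.le (i + ℓ))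
      filter_upwards [h1, h2, h3] with ω e1 e2 e3
      rw [e1, Pi.sub_apply, e2, e3, sub_self]
      rfl
  set R : ℕ → Ω → ℝ := fun L ω =>
    ∑ j ∈ Finset.range L, ∑ i ∈ Finset.range n, D (m + j) i ω with hR
  have hRtel : ∀ L ω, R L ω
      = ∑ i ∈ Finset.range n, ((μ[x i | ℱ (i + m + L)]) ω - (μ[x i | ℱ (i + m)]) ω) := fun L ω => by
    simp only [hR]
    rw [Finset.sum_comm]
    refine Finset.sum_congr rfl fun i _ => ?_
    simp only [hD, Pi.sub_apply, ← add_assoc]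
    exact Finset.sum_range_sub (fun L => (μ[x i | ℱ (i + m + L)]) ω) L
  have hRle : ∀ L, eLpNorm (R L) (ENNReal.ofReal p) μ ≤ c * ∑' j, θ (m + j) := fun L => by
    have e : R L = ∑ j ∈ Finset.range L, fun ω => ∑ i ∈ Finset.range n, D (m + j) i ω := by
      ext ω
      simp only [hR, Finset.sum_apply]
    rw [e]
    refine (eLpNorm_sum_le (fun j _ => hDsm (m + j)) ?_).trans ?_
    · rw [ENNReal.one_le_ofReal]
      linarith
    · calc ∑ j ∈ Finset.range L, eLpNorm (fun ω => ∑ i ∈ Finset.range n, D (m + j) i ω)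
            (ENNReal.ofReal p) μ ≤ ∑ j ∈ Finset.range L, c * θ (m + j) :=
            Finset.sum_le_sum fun j _ => hDsum (m + j)
        _ = c * ∑ j ∈ Finset.range L, θ (m + j) := (Finset.mul_sum _ _ _).symm
        _ ≤ _ := mul_le_mul_right (ENNReal.sum_le_tsum _) c
  -- The bound is uniform in the truncation level `L`, so it passes to the almost sure limit; Lévy's
  -- upward theorem identifies that limit.
  refine Lp.eLpNorm_le_of_ae_tendsto (u := atTop) (f := R) (Eventually.of_forall hRle)
    (fun L => (Finset.aestronglyMeasurable_fun_sum _ fun j _ => hDsm (m + j))) ?_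
  have hlim := ae_all_iff.2 fun i => (hfi i).tendsto_ae_condExp (hx i)
  filter_upwards [hlim] with ω hω
  simp only [hRtel]
  refine tendsto_finsetSum _ fun i _ => Tendsto.sub_const ?_ _
  exact (hω i).comp (tendsto_atTop_mono (fun L => Nat.le_add_left L (i + m)) tendsto_id)

/-- The constant in front of the polynomial term of the tail bound. -/
noncomputable def tailConst (p : ℝ) : ℝ := (2 * √(2 * (p ^ 2 * 2 ^ p))) ^ p

theorem tailConst_pos {p : ℝ} (hp : 0 < p) : 0 < tailConst p := by
  unfold tailConst
  positivity

/-- Markov's inequality at order `p`: `√n` cancels, and the halved threshold accounts for the outer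
factor 2 in `tailConst`. -/
theorem measure_abs_ge_le_of_eLpNorm_le {p : ℝ} (hp : 0 < p) {f : Ω → ℝ}
    (hf : AEStronglyMeasurable f μ) {n : ℕ} (hn : 0 < n) {Θ : ℝ≥0∞}
    (h : eLpNorm f (ENNReal.ofReal p) μ ≤ ENNReal.ofReal (√(2 * (p ^ 2 * 2 ^ p)) * √n) * Θ)
    {τ : ℝ} (hτ : 0 < τ) :
    μ {ω | τ * √n / 2 ≤ |f ω|} ≤ ENNReal.ofReal (tailConst p) * Θ ^ p / ENNReal.ofReal τ ^ p := by
  have hn' : (0 : ℝ) < √n := Real.sqrt_pos.2 (Nat.cast_pos.2 hn)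
  have ha : 0 < τ * √n / 2 := by positivity
  have hset : {ω | τ * √n / 2 ≤ |f ω|} = {ω | ENNReal.ofReal (τ * √n / 2) ≤ ‖f ω‖ₑ} := by
    ext ω
    simp only [Set.mem_ofPred_eq]
    rw [Real.enorm_eq_ofReal_abs, ENNReal.ofReal_le_ofReal_iff (abs_nonneg _)]
  have h1 := meas_ge_le_mul_pow_eLpNorm_enorm μ (p := ENNReal.ofReal p) (by simpa using hp)
    ENNReal.ofReal_ne_top hf (ε := ENNReal.ofReal (τ * √n / 2)) (by simpa using ha)
    (fun h => absurd h ENNReal.ofReal_ne_top)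
  rw [ENNReal.toReal_ofReal hp.le] at h1
  rw [hset]
  refine h1.trans ?_
  rw [← ENNReal.mul_rpow_of_nonneg _ _ hp.le]
  have h2 : (ENNReal.ofReal (τ * √n / 2))⁻¹ * eLpNorm f (ENNReal.ofReal p) μ
      ≤ ENNReal.ofReal (2 * √(2 * (p ^ 2 * 2 ^ p))) * Θ / ENNReal.ofReal τ := by
    refine (mul_le_mul_right h _).trans (le_of_eq ?_)
    rw [← mul_assoc, ← ENNReal.ofReal_inv_of_pos ha, ← ENNReal.ofReal_mul (by positivity),
      ENNReal.div_eq_inv_mul, ← ENNReal.ofReal_inv_of_pos hτ, ← mul_assoc (ENNReal.ofReal τ⁻¹),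
      ← ENNReal.ofReal_mul (by positivity)]
    congr 2
    field_simp
  refine (ENNReal.rpow_le_rpow h2 hp.le).trans (le_of_eq ?_)
  rw [ENNReal.div_rpow_of_nonneg _ _ hp.le, ENNReal.mul_rpow_of_nonneg _ _ hp.le,
    ENNReal.ofReal_rpow_of_nonneg (by positivity) hp.le]
  rfl

theorem measure_abs_sum_ge_le [IsProbabilityMeasure μ] {p : ℝ} (hp : 2 < p)
    (ℱ : Filtration ℕ m0) {x : ℕ → Ω → ℝ} (hx : ∀ i, StronglyMeasurable[⨆ k, ℱ k] (x i)) {B : ℝ}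
    (hB0 : 0 < B) (hB : ∀ i, ∀ᵐ ω ∂μ, |x i ω| ≤ B) (h0 : ∀ i, μ[x i | ℱ i] =ᵐ[μ] 0) {θ : ℕ → ℝ≥0∞}
    (hθ : ∀ i ℓ, eLpNorm (μ[x i | ℱ (i + ℓ + 1)] - μ[x i | ℱ (i + ℓ)]) (ENNReal.ofReal p) μ ≤ θ ℓ)
    {m n : ℕ} (hm : 0 < m) (hmn : m ≤ n) {τ : ℝ} (hmτ : m ≤ τ) :
    μ {ω | τ * √n ≤ |∑ i ∈ Finset.range n, x i ω|}
      ≤ ENNReal.ofReal (2 * Real.exp (-(τ / (16 * B ^ 2))))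
        + ENNReal.ofReal (tailConst p) * (∑' j, θ (m + j)) ^ p / ENNReal.ofReal τ ^ p := by
  have hm' : (0 : ℝ) < m := Nat.cast_pos.2 hm
  have hτ : 0 < τ := hm'.trans_le hmτ
  have hn : 0 < n := hm.trans_le hmn
  have hn' : (0 : ℝ) < n := Nat.cast_pos.2 hn
  set Y : ℕ → Ω → ℝ := fun i => μ[x i | ℱ (i + m)] with hY
  have hYm : ∀ i, StronglyMeasurable[ℱ (i + m)] (Y i) := fun i => stronglyMeasurable_condExp
  have hsub : {ω | τ * √n ≤ |∑ i ∈ Finset.range n, x i ω|}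
      ⊆ {ω | τ * √n / 2 ≤ |∑ i ∈ Finset.range n, Y i ω|}
        ∪ {ω | τ * √n / 2 ≤ |∑ i ∈ Finset.range n, (x i ω - Y i ω)|} := fun ω hω => by
    simp only [Set.mem_union, Set.mem_ofPred_eq] at hω ⊢
    by_contra! hcon
    have h1 := abs_add_le (∑ i ∈ Finset.range n, Y i ω) (∑ i ∈ Finset.range n, (x i ω - Y i ω))
    rw [← Finset.sum_add_distrib] at h1
    simp only [add_sub_cancel] at h1
    linarith [hcon.1, hcon.2]
  refine (measure_mono hsub).trans ((measure_union_le _ _).trans (add_le_add ?_ ?_))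
  -- Enough blocks of length `m` to cover `n`, yet `q * m ≤ 2 * n` because `m ≤ n`. With `m ≤ τ`
  -- this gives `q * m ^ 2 ≤ 2 * n * τ`, hence the constant 16.
  · set q := n / m + 1 with hq
    have hnq : n ≤ m * q := (Nat.lt_mul_div_succ n hm).le
    have h := measure_abs_sum_ge_le_of_step (μ := μ) (𝒢 := ℱ) ℱ.le ℱ.mono' hm hYm hB0
      (fun i => ae_bdd_abs_condExp_of_ae_bdd_abs (hB i))
      (fun i => (condExp_condExp_of_le (ℱ.mono (Nat.le_add_right i m)) (ℱ.le _)).trans (h0 i))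
      (Nat.succ_pos (n / m)) hnq (x := τ * √n / 2) (by positivity)
    refine h.trans (ENNReal.ofReal_le_ofReal ?_)
    refine mul_le_mul_of_nonneg_left (Real.exp_le_exp.2 (neg_le_neg ?_)) zero_le_two
    have hqm : (q : ℝ) * m ≤ 2 * n := by
      have h1 : (n / m + 1) * m ≤ 2 * n := by
        have := Nat.div_mul_le_self n m
        rw [add_mul, one_mul]
        omega
      exact_mod_cast h1
    have hq' : (0 : ℝ) < q := Nat.cast_pos.2 (Nat.succ_pos _)
    have hsq : (τ * √n / 2) ^ 2 = τ ^ 2 * n / 4 := by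
      rw [div_pow, mul_pow, Real.sq_sqrt hn'.le]
      norm_num
    rw [hsq, div_le_div_iff₀ (by positivity) (by positivity)]
    have h2 : (q : ℝ) * m * m ≤ 2 * n * τ := by gcongr
    have h3 : 0 ≤ τ * B ^ 2 := by positivity
    have h4 := mul_le_mul_of_nonneg_left h2 h3
    change τ * (2 * (q : ℝ) * (m * B) ^ 2) ≤ τ ^ 2 * n / 4 * (16 * B ^ 2)
    nlinarith
  · refine measure_abs_ge_le_of_eLpNorm_le (by linarith) ?_ hn
      (eLpNorm_sum_sub_condExp_le hp ℱ hx hB hθ m n) hτ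
    exact (Finset.stronglyMeasurable_fun_sum _ fun i _ => ((hx i).mono (iSup_le ℱ.le)).sub
      ((hYm i).mono (ℱ.le _))).aestronglyMeasurable

end Causal

/-! ### Causal processes, time reversal and asymptotics -/

namespace Causal

variable {Ω E : Type*} [MeasurableSpace Ω] [MeasurableSpace E] {μ : Measure Ω}
  {ε : ℤ → Ω → E} {g : ℤ → (ℕ → E) → ℝ}

/-- The σ-algebras of the innovations after time `n - k`, as a filtration in `k`. -/
def futureFiltration (hε : ∀ t, Measurable (ε t)) (n : ℤ) : Filtration ℕ ‹MeasurableSpace Ω› where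
  seq k := futureSigma ε (n + 1 - k)
  mono' _ _ hij := futureSigma_anti (by omega)
  le' _ := futureSigma_le hε _

theorem sum_Icc_eq_sum_range (a : ℤ → ℝ) (n : ℕ) :
    ∑ t ∈ Finset.Icc (1 : ℤ) n, a t = ∑ i ∈ Finset.range n, a (n - i) := by
  refine Finset.sum_nbij' (fun t => (n - t).toNat) (fun i => (n : ℤ) - i) ?_ ?_ ?_ ?_ ?_
  · intro t ht
    rw [Finset.mem_Icc] at ht
    rw [Finset.mem_range]
    omega
  · intro i hi
    rw [Finset.mem_range] at hi
    rw [Finset.mem_Icc]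
    omega
  · intro t ht
    rw [Finset.mem_Icc] at ht
    omega
  · intro i hi
    omega
  · intro t ht
    rw [Finset.mem_Icc] at ht
    congr 1
    omega

/-- A non-asymptotic tail bound for a bounded causal process. -/
theorem measure_abs_sum_proc_ge_le [IsProbabilityMeasure μ] (hε : IsIID μ ε)
    (hg : ∀ t, Measurable (g t)) (h0 : ∀ t, ∫ ω, proc g ε t ω ∂μ = 0) {B : ℝ} (hB0 : 0 < B)
    (hB : ∀ t, ∀ᵐ ω ∂μ, |proc g ε t ω| ≤ B) {d : ℝ} (hd : 2 < d) {m n : ℕ} (hm : 0 < m)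
    (hmn : m ≤ n) {τ : ℝ} (hmτ : m ≤ τ) :
    μ {ω | τ * √n ≤ |∑ t ∈ Finset.Icc (1 : ℤ) n, proc g ε t ω|}
      ≤ ENNReal.ofReal (2 * Real.exp (-(τ / (16 * B ^ 2))))
        + ENNReal.ofReal (tailConst d) * Theta μ g ε d m ^ d / ENNReal.ofReal τ ^ d := by
  simp only [sum_Icc_eq_sum_range]
  -- Time runs backwards from `n`, so that the future σ-algebras increase with the index.
  refine measure_abs_sum_ge_le hd (futureFiltration hε.measurable n)
    (x := fun i => proc g ε ((n : ℤ) - i)) (fun i => ?_) hB0 (fun i => hB _) (fun i => ?_)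
    (θ := fun ℓ => ⨆ t : ℤ, couplingNorm μ g ε d ℓ t) (fun i ℓ => ?_) hm hmn hmτ
  · refine stronglyMeasurable_proc hg fun u _ => ?_
    -- This index reaches back to time `u`; truncation by `toNat` is harmless, as index 0 already
    -- covers every `u ≥ n + 1`.
    have hle : futureSigma ε ((n : ℤ) + 1 - ((n + 1 - u).toNat : ℕ))
        ≤ ⨆ k, futureFiltration hε.measurable n k :=
      le_iSup (fun k => futureFiltration hε.measurable n k) (n + 1 - u).toNat
    exact (measurable_comap_block (Set.mem_Ici.2 (by omega))).mono hle le_rfl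
  · have h := condExp_proc_future_eq_zero hε hg (h0 ((n : ℤ) - i))
    rwa [sub_add_eq_add_sub] at h
  · have h := eLpNorm_condExp_sub_le_couplingNorm hε hg (by linarith : 1 ≤ d)
      (integrable_of_abs_le (stronglyMeasurable_proc hg fun u _ =>
        hε.measurable u).aestronglyMeasurable (hB ((n : ℤ) - i))) ℓ
    have e1 : (n : ℤ) + 1 - ((i + ℓ + 1 : ℕ) : ℤ) = n - i - ℓ := by
      push_cast
      ring
    have e2 : (n : ℤ) + 1 - ((i + ℓ : ℕ) : ℤ) = n - i - ℓ + 1 := by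
      push_cast
      ring
    change eLpNorm (μ[_ | futureSigma ε _] - μ[_ | futureSigma ε _]) _ μ ≤ _
    rw [e1, e2]
    exact h.trans (le_iSup (fun t => couplingNorm μ g ε d ℓ t) ((n : ℤ) - i))

/-- A stationary process obeying `|X_t| ≤ √n` for `1 ≤ t ≤ n` and large `n` is bounded. -/
theorem IsStationary.exists_bound {X : ℤ → Ω → ℝ} (hX : IsStationary μ X)
    (hb : ∀ᶠ n : ℕ in atTop, ∀ t ∈ Finset.Icc (1 : ℤ) n, ∀ᵐ ω ∂μ, |X t ω| ≤ √n) :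
    ∃ B : ℝ, 0 < B ∧ ∀ t, ∀ᵐ ω ∂μ, |X t ω| ≤ B := by
  obtain ⟨n, hn, hn1⟩ := (hb.and (eventually_ge_atTop 1)).exists
  refine ⟨√n, Real.sqrt_pos.2 (Nat.cast_pos.2 hn1), fun t => ?_⟩
  have h1 := hn 1 (Finset.mem_Icc.2 ⟨le_rfl, by exact_mod_cast hn1⟩)
  have h2 := (hX (t - 1)).symm.comp (measurable_pi_apply (1 : ℤ))
  have h3 := h2.ae_mem_snd (t := {y : ℝ | |y| ≤ √n})
    (measurableSet_le continuous_abs.measurable measurable_const) (by simpa using h1)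
  simpa using h3

theorem measure_abs_sum_gt_eq_zero {X : ℤ → Ω → ℝ} {B : ℝ}
    (hB : ∀ t, ∀ᵐ ω ∂μ, |X t ω| ≤ B) {n : ℕ} {x : ℝ} (hx : n * B < x) :
    μ {ω | x ≤ |∑ t ∈ Finset.Icc (1 : ℤ) n, X t ω|} = 0 := by
  have h : ∀ᵐ ω ∂μ, ¬ x ≤ |∑ t ∈ Finset.Icc (1 : ℤ) n, X t ω| := by
    filter_upwards [abs_sum_range_le_of_ae (fun i : ℕ => hB ((n : ℤ) - i)) n] with ω hω
    rw [sum_Icc_eq_sum_range, not_le]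
    exact hω.trans_lt hx
  simpa [ae_iff] using h

/-- Bounding the logarithm by its argument gives `c n ≤ δ * τ n / log n`, which is all that is
needed. -/
theorem eventually_exp_neg_le_rpow {τ c : ℕ → ℝ} (hτ : ∀ n, 0 < τ n)
    (hc : c =o[atTop] fun n : ℕ => Real.log (⌊τ n / Real.log n⌋₊ : ℝ)) {δ : ℝ} (hδ : 0 < δ) :
    ∀ᶠ n : ℕ in atTop, Real.exp (-(τ n * δ)) ≤ (n : ℝ) ^ (-(c n)) := by
  filter_upwards [hc.def hδ, eventually_gt_atTop 1] with n h hn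
  have hn' : (1 : ℝ) < n := by exact_mod_cast hn
  have hlog : 0 < Real.log n := Real.log_pos hn'
  have hr : 0 ≤ τ n / Real.log n := (div_pos (hτ n) hlog).le
  rw [Real.rpow_def_of_pos (by linarith), Real.exp_le_exp, mul_neg, neg_le_neg_iff]
  have h1 : Real.log (⌊τ n / Real.log n⌋₊ : ℝ) ≤ τ n / Real.log n :=
    (Real.log_le_self (Nat.cast_nonneg _)).trans (Nat.floor_le hr)
  rw [Real.norm_eq_abs, Real.norm_of_nonneg (Real.log_natCast_nonneg _)] at h
  have h2 : c n ≤ δ * (τ n / Real.log n) :=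
    (le_abs_self _).trans (h.trans (mul_le_mul_of_nonneg_left h1 hδ.le))
  calc Real.log n * c n ≤ Real.log n * (δ * (τ n / Real.log n)) :=
        mul_le_mul_of_nonneg_left h2 hlog.le
    _ = τ n * δ := by field_simp

theorem eventually_one_le_of_tendsto_div_log {τ : ℕ → ℝ}
    (hτ : Tendsto (fun n : ℕ => τ n / Real.log n) atTop atTop) : ∀ᶠ n : ℕ in atTop, 1 ≤ τ n := by
  have hlog : Tendsto (fun n : ℕ => Real.log n) atTop atTop :=
    Real.tendsto_log_atTop.comp tendsto_natCast_atTop_atTop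
  filter_upwards [hτ.eventually_ge_atTop 1, hlog.eventually_ge_atTop 1] with n h1 h2
  rw [le_div_iff₀ (by linarith)] at h1
  linarith

end Causal

theorem proposition1 (d : ℝ) (hd : 4 ≤ d) :
    ∃ K : ℝ, 0 < K ∧
      ∀ (Ω : Type*) (E : Type*) [MeasurableSpace Ω] [MeasurableSpace E]
        (μ : Measure Ω) [IsProbabilityMeasure μ]
        (ε : ℤ → Ω → E) (g : ℤ → (ℕ → E) → ℝ),
        Causal.IsIID μ ε →
        (∀ t, Measurable (g t)) →
        Causal.IsStationary μ (Causal.proc g ε) →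
        (∀ t, MemLp (Causal.proc g ε t) (ENNReal.ofReal d) μ) →
        (∀ t, ∫ ω, Causal.proc g ε t ω ∂μ = 0) →
        (∀ᶠ n : ℕ in atTop, ∀ t ∈ Finset.Icc (1 : ℤ) n,
          ∀ᵐ ω ∂μ, |Causal.proc g ε t ω| ≤ Real.sqrt n) →
        ∀ τ c : ℕ → ℝ,
          (∀ n, 0 < τ n) →
          Tendsto (fun n : ℕ => τ n / Real.log n) atTop atTop →
          c =o[atTop] (fun n : ℕ => Real.log (⌊τ n / Real.log n⌋₊ : ℝ)) →
          ∃ C : ℝ, ∀ᶠ n : ℕ in atTop,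
            μ {ω | τ n / Real.sqrt n ≤
                |(1 / (n : ℝ)) * ∑ t ∈ Finset.Icc (1 : ℤ) n, Causal.proc g ε t ω|}
              ≤ ENNReal.ofReal (C * (n : ℝ) ^ (-(c n)))
                + ENNReal.ofReal K * Causal.Theta μ g ε d ⌊τ n⌋₊ ^ d
                  / ENNReal.ofReal (τ n) ^ d := by
  refine ⟨Causal.tailConst d, Causal.tailConst_pos (by linarith), ?_⟩
  intro Ω E _ _ μ _ ε g hε hg hstat _ h0 hb τ c hτ hτlog hc
  obtain ⟨B, hB0, hB⟩ := hstat.exists_bound hb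
  -- The 2 comes from the two-sided Azuma–Hoeffding bound.
  refine ⟨2, ?_⟩
  filter_upwards [Causal.eventually_exp_neg_le_rpow hτ hc (δ := (16 * B ^ 2)⁻¹) (by positivity),
    Causal.eventually_one_le_of_tendsto_div_log hτlog, eventually_ge_atTop 1,
    eventually_ge_atTop ⌈B ^ 2⌉₊] with n hexp hτ1 hn hnB
  have hn' : (0 : ℝ) < n := Nat.cast_pos.2 hn
  have hsq : 0 < √(n : ℝ) := Real.sqrt_pos.2 hn'
  have hset : {ω | τ n / √n ≤ |(1 / (n : ℝ)) * ∑ t ∈ Finset.Icc (1 : ℤ) n, Causal.proc g ε t ω|}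
      = {ω | τ n * √n ≤ |∑ t ∈ Finset.Icc (1 : ℤ) n, Causal.proc g ε t ω|} := by
    ext ω
    simp only [Set.mem_ofPred_eq]
    rw [abs_mul, abs_of_pos (by positivity : 0 < 1 / (n : ℝ)), one_div, inv_mul_eq_div,
      div_le_div_iff₀ hsq hn']
    nth_rewrite 1 [← Real.mul_self_sqrt hn'.le]
    rw [← mul_assoc, mul_le_mul_iff_left₀ hsq]
  rw [hset]
  -- The truncation lag `⌊τ n⌋₊` must not exceed `n`. If `τ n > n`, the threshold exceeds `n * B`
  -- once `B ≤ √n`, and the event is null.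
  rcases le_or_gt (τ n) n with hle | hgt
  · refine (Causal.measure_abs_sum_proc_ge_le hε hg h0 hB0 hB (by linarith : 2 < d)
      (m := ⌊τ n⌋₊) (Nat.floor_pos.2 hτ1) (Nat.floor_le_of_le hle)
      (Nat.floor_le (hτ n).le)).trans ?_
    refine add_le_add (ENNReal.ofReal_le_ofReal ?_) le_rfl
    rw [div_eq_mul_inv]
    exact mul_le_mul_of_nonneg_left hexp zero_le_two
  · have hBn : B ≤ √n := Real.le_sqrt_of_sq_le (Nat.ceil_le.1 hnB)
    rw [Causal.measure_abs_sum_gt_eq_zero hB ((mul_le_mul_of_nonneg_left hBn hn'.le).trans_lt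
      (mul_lt_mul_of_pos_right hgt hsq))]
    exact zero_le
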